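/- **Theorem (gapless excitations of the 111 interface in the XXZ model).** For a finite $\Lambda\subset\mathbb Z^3$ and $\Delta>1$ let, on $\bigotimes_{x\in\Lambda}\mathbb C^2$, $$H_\Lambda=-\sum_{x,y\in\Lambda,\ |x-y|=1}\Big(\tfrac1\Delta(S^1_xS^1_y+S^2_xS^2_y)+S^3_xS^3_y\Big)$$ (sum over ordered pairs, $S^i$ the spin-1/2 matrices), and let $$H^{111}_\Lambda=H_\Lambda+2A(\Delta)\sum_{x\in\Lambda}\Big(\sum_{y\in\Lambda,\ |x-y|=1}(\ell(y)-\ell(x))\Big)S^3_x,\qquad A(\Delta)=\tfrac12\sqrt{1-\Delta^{-2}},\quad \ell(x)=x_1+x_2+x_3 .$$ The second term is a boundary field (it vanishes at sites all of whose neighbours are in $\Lambda$) that favours an interface orthogonal to the 111 direction, with down spins below and up spins above. Both operators conserve the number of down spins. A canonical interface ground state with $n$ down spins is a nonzero vector $\psi$ that minimizes the energy $E(\varphi)=\langle\varphi,H^{111}_\Lambda\varphi\rangle/\langle\varphi,\varphi\rangle$ among the nonzero vectors with exactly $n$ down spins. For a set $S$ of sites, the excitations of $\psi$ localized in $S$ are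 the vectors $X\psi\neq0$ orthogonal to $\psi$, where $X$ is an operator acting only on the spins in $S\cap\Lambda$ that commutes with $\sum_{x\in\Lambda}S^3_x$; their gap $\gamma(\psi,S)$ is the infimum of $E(X\psi)-E(\psi)$ over all these excitations. There is a function $\delta$ with values $\delta(q,\nu)\in[0,1/2)$ for $0<q<1$, $0\le\nu<1$, such that the following holds. Let $0<q<1$, $\Delta=(q+q^{-1})/2$, $0\le\nu<1$, $m\in\mathbb Z$. Let $(\Lambda_k)$ be finite volumes, each connected as a nearest-neighbour graph, such that every site of $\mathbb Z^3$ belongs to $\Lambda_k$ for all large $k$, and such that $\Lambda_k$ consists of sites with $a_k<\ell(x)\le b_k$ (with $a_k,b_k\in\mathbb Z$) and has the same number $A_k$ of sites in each plane $\ell(x)=l$, $a_k<l\le b_k$. Let $n_k\in\mathbb{N}$ be numbers of down spins with $n_k/A_k+a_k\to m+\nu$; that is, in the limit the planes up to height $m$ are full and the filling factor of the interface plane $\ell(x)=m+1$ is $\nu$. Then for every $R>70$ and every $c\in\mathbb R^3$ there is a height $h\in\mathbb{N}$ such that, with $C_R$ the set of sites $x$ with $|\ell(x)|\le h$ at distance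 at most $R$ from the line through $c$ in the direction $(1,1,1)$, for all sufficiently large $k$: canonical interface ground states $\psi$ with $n_k$ down spins in $\Lambda_k$ exist, and each of them possesses excitations localized in $C_R$, whose gap $\gamma_R=\gamma(\psi,C_R)$ is a finite infimum satisfying $$\gamma_R\le 100\,\frac{q^{2(1-\delta(q,\nu))}}{1-q^2}\,\frac1{R^2}.$$ -/

import Mathlib

open Filter Topology Matrix

noncomputable section

namespace XXZ

/-- Sites of the cubic lattice `ℤ³`. -/
abbrev Site := Fin 3 → ℤ

/-- The height `x₁ + x₂ + x₃` of a site in the 111 direction; its level sets are the 111 planes. -/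
def level (x : Site) : ℤ := ∑ i, x i

/-- Nearest neighbours of `ℤ³` (for integer points `|x - y| = 1` means the same in the `ℓ¹` and in
the Euclidean norm). -/
def Neighbour (x y : Site) : Prop := ∑ i, |x i - y i| = 1

instance (x y : Site) : Decidable (Neighbour x y) := by unfold Neighbour; infer_instance

/-- The nearest-neighbour graph on `ℤ³`. -/
def latticeGraph : SimpleGraph Site where
  Adj := Neighbour
  symm := ⟨by
    intro x y h
    unfold Neighbour at h ⊢
    simpa only [abs_sub_comm] using h⟩
  loopless := ⟨by
    intro x h
    simp [Neighbour] at h⟩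

/-- Spin configurations in the volume `Λ`: `0` is spin up, `1` is spin down. They label the standard
orthonormal basis of `⨂_{x ∈ Λ} ℂ²`. -/
abbrev Config (Λ : Finset Site) := Λ → Fin 2

/-- Vectors of `⨂_{x ∈ Λ} ℂ²`, in the standard basis. -/
abbrev State (Λ : Finset Site) := Config Λ → ℂ

/-- Observables in the volume `Λ`, in the standard basis. -/
abbrev Observable (Λ : Finset Site) := Matrix (Config Λ) (Config Λ) ℂ

/-- The first spin-1/2 matrix. -/
def S1 : Matrix (Fin 2) (Fin 2) ℂ := !![0, 1 / 2; 1 / 2, 0]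
/-- The second spin-1/2 matrix. -/
def S2 : Matrix (Fin 2) (Fin 2) ℂ := !![0, -Complex.I / 2; Complex.I / 2, 0]
/-- The third spin-1/2 matrix. -/
def S3 : Matrix (Fin 2) (Fin 2) ℂ := !![1 / 2, 0; 0, -1 / 2]

variable {Λ : Finset Site}

/-- The one-site matrix `S` acting at the site `x`, tensored with the identity elsewhere. -/
def at_ (S : Matrix (Fin 2) (Fin 2) ℂ) (x : Λ) : Observable Λ :=
  Matrix.of fun σ τ => if ∀ y, y ≠ x → σ y = τ y then S (σ x) (τ x) else 0

/-- The XXZ Hamiltonian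
`H_Λ = - ∑_{x, y ∈ Λ, |x - y| = 1} (1/Δ) (S¹ₓ S¹ᵧ + S²ₓ S²ᵧ) + S³ₓ S³ᵧ`,
the sum running over ordered pairs. -/
def hamiltonian (Δ : ℝ) (Λ : Finset Site) : Observable Λ :=
  -∑ x : Λ, ∑ y : Λ, if Neighbour x y then
      ((1 / Δ : ℝ) : ℂ) • (at_ S1 x * at_ S1 y + at_ S2 x * at_ S2 y) + at_ S3 x * at_ S3 y
    else 0

/-- The strength `A(Δ) = (1/2) √(1 - Δ⁻²)` of the boundary field. -/
def fieldStrength (Δ : ℝ) : ℝ := 1 / 2 * Real.sqrt (1 - 1 / Δ ^ 2)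

/-- Number of neighbours of `x` in `Λ` that lie above `x`, minus the number of those below;
it vanishes if all six neighbours of `x` are in `Λ`. -/
def boundaryDefect (x : Λ) : ℤ := ∑ y : Λ, if Neighbour x y then level y - level x else 0

/-- The XXZ Hamiltonian with the boundary field that favours a 111 interface with down spins below
and up spins above. The factor 2 goes with the sum over ordered pairs in `hamiltonian`. -/
def interfaceHamiltonian (Δ : ℝ) (Λ : Finset Site) : Observable Λ :=
  hamiltonian Δ Λ +
    ∑ x : Λ, ((2 * fieldStrength Δ * (boundaryDefect x : ℝ) : ℝ) : ℂ) • at_ S3 x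

/-- The third component of the total spin. -/
def totalS3 (Λ : Finset Site) : Observable Λ := ∑ x : Λ, at_ S3 x

/-- The sector with exactly `n` down spins. -/
def sector (Λ : Finset Site) (n : ℕ) : Set (State Λ) :=
  {ψ | ∀ σ, ψ σ ≠ 0 → (Finset.univ.filter fun x : Λ => σ x = 1).card = n}

/-- The energy `⟨ψ, H ψ⟩ / ⟨ψ, ψ⟩` of a (nonzero) vector. -/
def energy (H : Observable Λ) (ψ : State Λ) : ℝ :=
  (star ψ ⬝ᵥ (H *ᵥ ψ)).re / (star ψ ⬝ᵥ ψ).re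

/-- `ψ` is a canonical 111 interface ground state: it minimizes the energy among the nonzero vectors
with exactly `n` down spins. -/
def IsGroundState (Δ : ℝ) (n : ℕ) (ψ : State Λ) : Prop :=
  ψ ∈ sector Λ n ∧ ψ ≠ 0 ∧
    ∀ φ ∈ sector Λ n, φ ≠ 0 →
      energy (interfaceHamiltonian Δ Λ) ψ ≤ energy (interfaceHamiltonian Δ Λ) φ

/-- `X` is localized in the set `S` of sites: it is of the form `Y ⊗ 1`, with `Y` acting on the
spins in `S ∩ Λ` and `1` the identity on the other spins. -/
def IsLocalizedIn (X : Observable Λ) (S : Set Site) : Prop :=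
  (∀ σ τ : Config Λ, (∃ x : Λ, (x : Site) ∉ S ∧ σ x ≠ τ x) → X σ τ = 0) ∧
  (∀ σ τ σ' τ' : Config Λ,
    (∀ x : Λ, (x : Site) ∉ S → σ x = τ x) → (∀ x : Λ, (x : Site) ∉ S → σ' x = τ' x) →
    (∀ x : Λ, (x : Site) ∈ S → σ x = σ' x ∧ τ x = τ' x) → X σ τ = X σ' τ')

/-- The energies, relative to the ground state `ψ`, of the excitations of `ψ` localized in `S`
in the canonical ensemble: the vectors `X ψ ≠ 0` orthogonal to `ψ`, where `X` is localized in `S`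
and conserves the number of down spins. -/
def excitationEnergies (Δ : ℝ) (ψ : State Λ) (S : Set Site) : Set ℝ :=
  {e | ∃ X : Observable Λ, IsLocalizedIn X S ∧ Commute X (totalS3 Λ) ∧
    X *ᵥ ψ ≠ 0 ∧ star ψ ⬝ᵥ (X *ᵥ ψ) = 0 ∧
    e = energy (interfaceHamiltonian Δ Λ) (X *ᵥ ψ) - energy (interfaceHamiltonian Δ Λ) ψ}

/-- The energy gap of the excitations of `ψ` localized in `S`. -/
def gap (Δ : ℝ) (ψ : State Λ) (S : Set Site) : ℝ := sInf (excitationEnergies Δ ψ S)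

/-- The sites in the cylinder of radius `R` whose axis passes through the point `c` in the 111
direction, between the planes of heights `-h` and `h`. -/
def cylinder (c : EuclideanSpace ℝ (Fin 3)) (R : ℝ) (h : ℕ) : Set Site :=
  {x | (∃ t : ℝ, dist (WithLp.toLp 2 fun i => (x i : ℝ)) (c + t • !₂[(1 : ℝ), 1, 1]) ≤ R) ∧
    |level x| ≤ h}

/-- `Λ` is a connected finite volume composed of the 111 planes of heights `a + 1, …, b`, each of
which has exactly `A` sites in `Λ`. -/
structure IsLayeredVolume (Λ : Finset Site) (a b : ℤ) (A : ℕ) : Prop where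
  level_mem : ∀ x ∈ Λ, level x ∈ Set.Ioc a b
  card_level : ∀ l ∈ Set.Ioc a b, (Λ.filter fun x => level x = l).card = A
  connected : (latticeGraph.induce (Λ : Set Site)).Connected

end XXZ

end

/-!
# Gapless excitations of the 111 interface

**Frustration freeness.** With `Δ = (q + q⁻¹) / 2`, each bond, together with its share of the
boundary field, contributes twice the projection onto `↑↓ - q ↓↑` (upper spin second), up to a
constant. So the energy is a constant plus a sum of squares (`energy_eq`), which vanishes exactly
when the amplitude drops by a factor `q` whenever a down spin moves up by one plane. Since the
transpositions along the bonds of a connected volume generate all permutations, the canonical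
ground state is unique up to a factor (`IsGroundState.eq_smul`). Its squared amplitudes are those of
independent occupation numbers, with odds `q ^ (2 * level x)`, conditioned on the number of down
spins.

**Trial excitations.** Let `X` multiply by the centred statistic `∑ f x`, summed over the down
spins. Its excitation energy is `2 / (1 + q ^ 2)` times the ratio of the Dirichlet form, that is, of
the sum of `P(x up, y down) (f x - f y) ^ 2` over the bonds from `x` up to `y`, to the variance of
the statistic (`mem_excitationEnergies`).

**Correlations.** Conditioned occupation numbers are negatively correlated, because elementary
symmetric polynomials are log-concave (`occ₂_le_mul`). Their covariances with a given one add up to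
zero, and the sites of a plane play the same role, so a covariance is at most `1 / (A - 1)` in a
volume with `A` sites in each plane (`occ_mul_sub_occ₂_le`). No equivalence of ensembles is needed:
exchanging `x` and `y` relates `P(x up, y down)` to `P(x down, y up)`, and up to the covariance
`P(x up, y down)` is `q` times the geometric mean of the variances of the two occupation numbers
(`hole_particle_le_variance`). The same two facts give exponential tails away from the interface
(`occ_mul_hole_le`), from which the filling condition yields a plane, `m` or `m + 1`, whose variance
is bounded from below (`exists_partially_filled`).

**Geometry.** The function `f` is, in each plane of height between `-h` and `h`, a tent of slope one
over a hexagon of radius `N ≈ 0.68 R` around the axis of the cylinder. In each plane its squares add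
up to at least `N ^ 4 / 2` (`le_sum_tent_sq`), and its squared differences along the bonds to the
next plane to at most `2 (2 N + 1) ^ 2` (`sum_up_le`). This bounds the excitation energy by about
`4 q (2 N + 1) ^ 2 / (N ^ 4 / 2) < 72 q / R ^ 2`. The planes `±h`, where the tent breaks off, are
almost frozen when `h` is large. What is left of the factor `100` absorbs all errors and allows
`δ < 1 / 2`.
-/

noncomputable section

namespace XXZ

/-! ### Independent Bernoulli variables conditioned on their sum -/

section CanonicalEnsemble

variable {V : Type*}

/-- The elementary symmetric polynomial of degree `n` in the weights `w x`, `x ∈ S`. -/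
def esym (w : V → ℝ) (S : Finset V) (n : ℕ) : ℝ := ∑ T ∈ S.powersetCard n, ∏ x ∈ T, w x

lemma esym_zero (w : V → ℝ) (S : Finset V) : esym w S 0 = 1 := by
  simp [esym]

lemma esym_nonneg {w : V → ℝ} (hw : ∀ x, 0 < w x) (S : Finset V) (n : ℕ) : 0 ≤ esym w S n :=
  Finset.sum_nonneg fun _ _ => Finset.prod_nonneg fun x _ => (hw x).le

lemma esym_pos {w : V → ℝ} (hw : ∀ x, 0 < w x) {S : Finset V} {n : ℕ} (hn : n ≤ S.card) :
    0 < esym w S n :=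
  Finset.sum_pos (fun _ _ => Finset.prod_pos fun x _ => hw x) (Finset.powersetCard_nonempty.2 hn)

section Mean

variable [Fintype V]

/-- The canonical expectation of `g`: the random set `T` of occupied sites has `n` elements and
probability proportional to `∏ x ∈ T, w x`. -/
def canonMean (w : V → ℝ) (n : ℕ) (g : Finset V → ℝ) : ℝ :=
  (∑ T ∈ Finset.univ.powersetCard n, (∏ x ∈ T, w x) * g T) / esym w Finset.univ n

lemma canonMean_add (w : V → ℝ) (n : ℕ) (g g' : Finset V → ℝ) :
    canonMean w n (fun T => g T + g' T) = canonMean w n g + canonMean w n g' := by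
  simp only [canonMean, mul_add, Finset.sum_add_distrib, add_div]

lemma canonMean_smul (w : V → ℝ) (n : ℕ) (a : ℝ) (g : Finset V → ℝ) :
    canonMean w n (fun T => a * g T) = a * canonMean w n g := by
  simp only [canonMean, mul_div_assoc', Finset.mul_sum]
  congr 1
  exact Finset.sum_congr rfl fun _ _ => by ring

lemma canonMean_sum {ι : Type*} (w : V → ℝ) (n : ℕ) (s : Finset ι) (g : ι → Finset V → ℝ) :
    canonMean w n (fun T => ∑ i ∈ s, g i T) = ∑ i ∈ s, canonMean w n (g i) := by
  simp only [canonMean, Finset.mul_sum]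
  rw [Finset.sum_comm, Finset.sum_div]

lemma canonMean_const {w : V → ℝ} (hw : ∀ x, 0 < w x) {n : ℕ} (hn : n ≤ Fintype.card V) (a : ℝ) :
    canonMean w n (fun _ => a) = a := by
  rw [canonMean, ← Finset.sum_mul]
  exact mul_div_cancel_left₀ a (esym_pos hw (by simpa using hn)).ne'

lemma canonMean_congr (w : V → ℝ) (n : ℕ) {g g' : Finset V → ℝ}
    (h : ∀ T, T.card = n → g T = g' T) : canonMean w n g = canonMean w n g' := by
  unfold canonMean
  congr 1
  exact Finset.sum_congr rfl fun T hT => by rw [h T (Finset.mem_powersetCard.1 hT).2]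

end Mean

variable [DecidableEq V]

/-- Summing over the `(n + 1)`-element sets that contain a given point. -/
lemma sum_powersetCard_mem (F : Finset V → ℝ) {S : Finset V} {x : V} (hx : x ∈ S) (n : ℕ) :
    ∑ T ∈ S.powersetCard (n + 1), (if x ∈ T then F T else 0) =
      ∑ T ∈ (S.erase x).powersetCard n, F (insert x T) := by
  rw [← Finset.sum_filter]
  refine Finset.sum_nbij' (fun T => T.erase x) (fun T => insert x T) ?_ ?_ ?_ ?_ ?_
  · intro T hT
    simp only [Finset.mem_filter, Finset.mem_powersetCard] at hT ⊢
    refine ⟨Finset.erase_subset_erase x hT.1.1, ?_⟩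
    rw [Finset.card_erase_of_mem hT.2, hT.1.2]
    rfl
  · intro T hT
    simp only [Finset.mem_filter, Finset.mem_powersetCard] at hT ⊢
    have hxT : x ∉ T := fun h => Finset.notMem_erase x S (hT.1 h)
    refine ⟨⟨Finset.insert_subset hx (hT.1.trans (Finset.erase_subset x S)), ?_⟩,
      Finset.mem_insert_self x T⟩
    rw [Finset.card_insert_of_notMem hxT, hT.2]
  · intro T hT
    exact Finset.insert_erase (Finset.mem_filter.1 hT).2
  · intro T hT
    have hxT : x ∉ T := fun h => Finset.notMem_erase x S ((Finset.mem_powersetCard.1 hT).1 h)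
    exact Finset.erase_insert hxT
  · intro T hT
    rw [Finset.insert_erase (Finset.mem_filter.1 hT).2]

lemma sum_prod_mem (w : V → ℝ) {S : Finset V} {x : V} (hx : x ∈ S) (n : ℕ) :
    ∑ T ∈ S.powersetCard (n + 1), (∏ z ∈ T, w z) * (if x ∈ T then 1 else 0) =
      w x * esym w (S.erase x) n := by
  simp only [mul_ite, mul_one, mul_zero]
  rw [sum_powersetCard_mem _ hx, esym, Finset.mul_sum]
  refine Finset.sum_congr rfl fun T hT => ?_
  have hxT : x ∉ T := fun h => Finset.notMem_erase x S ((Finset.mem_powersetCard.1 hT).1 h)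
  rw [Finset.prod_insert hxT]

lemma sum_prod_mem_mem (w : V → ℝ) {S : Finset V} {x y : V} (hx : x ∈ S) (hy : y ∈ S)
    (hxy : x ≠ y) (n : ℕ) :
    ∑ T ∈ S.powersetCard (n + 2), (∏ z ∈ T, w z) * (if x ∈ T ∧ y ∈ T then 1 else 0) =
      w x * w y * esym w ((S.erase x).erase y) n := by
  have h1 : ∀ T : Finset V, (∏ z ∈ T, w z) * (if x ∈ T ∧ y ∈ T then (1 : ℝ) else 0) =
      if x ∈ T then (∏ z ∈ T, w z) * (if y ∈ T then 1 else 0) else 0 := by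
    intro T
    by_cases h : x ∈ T <;> simp [h]
  simp only [h1]
  rw [sum_powersetCard_mem _ hx, mul_assoc,
    ← sum_prod_mem w (Finset.mem_erase.2 ⟨hxy.symm, hy⟩), Finset.mul_sum]
  refine Finset.sum_congr rfl fun T hT => ?_
  have hxT : x ∉ T := fun h => Finset.notMem_erase x S ((Finset.mem_powersetCard.1 hT).1 h)
  rw [Finset.prod_insert hxT]
  simp [hxy.symm]

lemma esym_erase (w : V → ℝ) {S : Finset V} {x : V} (hx : x ∈ S) (n : ℕ) :
    esym w S (n + 1) = esym w (S.erase x) (n + 1) + w x * esym w (S.erase x) n := by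
  rw [← sum_prod_mem w hx, esym, esym, ← sub_eq_iff_eq_add, ← Finset.sum_sub_distrib]
  have h : ∀ T : Finset V, (∏ z ∈ T, w z) - (∏ z ∈ T, w z) * (if x ∈ T then 1 else 0) =
      if x ∉ T then ∏ z ∈ T, w z else 0 := by
    intro T
    by_cases h : x ∈ T <;> simp [h]
  simp only [h]
  rw [← Finset.sum_filter]
  refine Finset.sum_congr ?_ fun _ _ => rfl
  ext T
  simp only [Finset.mem_filter, Finset.mem_powersetCard, Finset.subset_erase]
  tauto

/-- Log-concavity of the elementary symmetric polynomials in positive weights, in the form that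
passes through an induction on the number of weights. -/
lemma esym_logConcave {w : V → ℝ} (hw : ∀ x, 0 < w x) (S : Finset V) :
    ∀ i j : ℕ, i ≤ j → esym w S i * esym w S (j + 2) ≤ esym w S (i + 1) * esym w S (j + 1) := by
  induction S using Finset.induction_on with
  | empty =>
    intro i j _
    have h : esym w (∅ : Finset V) (j + 2) = 0 := by
      rw [esym, Finset.powersetCard_eq_empty.2 (by simp), Finset.sum_empty]
    rw [h, mul_zero]
    exact mul_nonneg (esym_nonneg hw _ _) (esym_nonneg hw _ _)
  | insert x S hx ih =>
    have key : ∀ n, esym w (insert x S) (n + 1) = esym w S (n + 1) + w x * esym w S n := by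
      intro n
      rw [esym_erase w (Finset.mem_insert_self x S), Finset.erase_insert hx]
    have hnn := esym_nonneg hw S
    have hwx := (hw x).le
    intro i j hij
    rcases i with _ | i
    · rw [key, key, key, esym_zero]
      have h1 := ih 0 j (Nat.zero_le j)
      rw [esym_zero] at h1
      have h2 := mul_nonneg (hnn 1) (hnn j)
      have h3 := mul_nonneg hwx (mul_nonneg hwx (hnn j))
      have h4 := mul_nonneg hwx h2
      simp only [esym_zero, zero_add] at h1 ⊢
      nlinarith
    · obtain ⟨j, rfl⟩ : ∃ j', j = j' + 1 := ⟨j - 1, by omega⟩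
      rw [key, key, key, key]
      have h1 := ih (i + 1) (j + 1) hij
      have h2 := ih i j (by omega)
      have h3 := ih i (j + 1) (by omega)
      have h4 : esym w S (i + 1) * esym w S (j + 2) ≤ esym w S (i + 2) * esym w S (j + 1) := by
        rcases (show i = j ∨ i + 1 ≤ j by omega) with rfl | h
        · exact (mul_comm _ _).le
        · exact ih (i + 1) j h
      have h5 := mul_le_mul_of_nonneg_left (h3.trans h4) hwx
      have h6 := mul_le_mul_of_nonneg_left (mul_le_mul_of_nonneg_left h2 hwx) hwx
      simp only [add_assoc, Nat.reduceAdd] at *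
      nlinarith

variable [Fintype V]

/-- The probability that `x` is occupied. -/
def occ (w : V → ℝ) (n : ℕ) (x : V) : ℝ := canonMean w n fun T => if x ∈ T then 1 else 0

/-- The probability that `x` and `y` are occupied. -/
def occ₂ (w : V → ℝ) (n : ℕ) (x y : V) : ℝ :=
  canonMean w n fun T => if x ∈ T ∧ y ∈ T then 1 else 0

lemma occ₂_self (w : V → ℝ) (n : ℕ) (x : V) : occ₂ w n x x = occ w n x := by
  simp [occ₂, occ]

lemma occ_nonneg {w : V → ℝ} (hw : ∀ x, 0 < w x) (n : ℕ) (x : V) : 0 ≤ occ w n x :=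
  div_nonneg (Finset.sum_nonneg fun T _ => mul_nonneg (Finset.prod_nonneg fun x _ => (hw x).le)
    (by dsimp only; split_ifs <;> norm_num)) (esym_nonneg hw _ _)

lemma occ_le_one {w : V → ℝ} (hw : ∀ x, 0 < w x) (n : ℕ) (x : V) : occ w n x ≤ 1 := by
  refine div_le_one_of_le₀ (Finset.sum_le_sum fun T _ => ?_) (esym_nonneg hw _ _)
  have := Finset.prod_nonneg (s := T) fun x _ => (hw x).le
  dsimp only
  split_ifs <;> linarith

lemma sum_occ {w : V → ℝ} (hw : ∀ x, 0 < w x) {n : ℕ} (hn : n ≤ Fintype.card V) :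
    ∑ x, occ w n x = n := by
  simp only [occ]
  rw [← canonMean_sum]
  rw [canonMean_congr w n (g' := fun _ => (n : ℝ)), canonMean_const hw hn]
  intro T hT
  simp [hT]

lemma sum_occ₂ (w : V → ℝ) (n : ℕ) (x : V) : ∑ y, occ₂ w n x y = n * occ w n x := by
  simp only [occ₂, occ]
  rw [← canonMean_sum, ← canonMean_smul]
  refine canonMean_congr w n fun T hT => ?_
  by_cases h : x ∈ T <;> simp [h, hT]

lemma esym_univ_pair {w : V → ℝ} {x y : V} (hxy : x ≠ y) (j : ℕ)
    : esym w Finset.univ (j + 2) =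
    esym w ((Finset.univ.erase x).erase y) (j + 2) +
      (w x + w y) * esym w ((Finset.univ.erase x).erase y) (j + 1) +
      w x * w y * esym w ((Finset.univ.erase x).erase y) j := by
  have hy : y ∈ Finset.univ.erase x := by simp [hxy.symm]
  rw [esym_erase w (Finset.mem_univ x) (j + 1), esym_erase w hy (j + 1), esym_erase w hy j]
  ring

lemma occ₂_eq {w : V → ℝ} {x y : V} (hxy : x ≠ y) (j : ℕ)
    : occ₂ w (j + 2) x y =
    w x * w y * esym w ((Finset.univ.erase x).erase y) j / esym w Finset.univ (j + 2) := by
  rw [occ₂, canonMean, sum_prod_mem_mem w (Finset.mem_univ x) (Finset.mem_univ y) hxy]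

lemma occ_eq_left {w : V → ℝ} {x y : V} (hxy : x ≠ y) (j : ℕ)
    : occ w (j + 2) x =
    (w x * esym w ((Finset.univ.erase x).erase y) (j + 1) +
      w x * w y * esym w ((Finset.univ.erase x).erase y) j) / esym w Finset.univ (j + 2) := by
  have hy : y ∈ Finset.univ.erase x := by simp [hxy.symm]
  rw [occ, canonMean, sum_prod_mem w (Finset.mem_univ x), esym_erase w hy j]
  ring

lemma occ_eq_right {w : V → ℝ} {x y : V} (hxy : x ≠ y) (j : ℕ)
    : occ w (j + 2) y =
    (w y * esym w ((Finset.univ.erase x).erase y) (j + 1) +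
      w x * w y * esym w ((Finset.univ.erase x).erase y) j) / esym w Finset.univ (j + 2) := by
  rw [occ_eq_left hxy.symm, Finset.erase_right_comm]
  ring

/-- Configurations with a hole at `x` and a particle at `y` correspond to those with a particle at
`x` and a hole at `y`, and their weights have the ratio `w y / w x`. -/
lemma occ_exchange {w : V → ℝ} {x y : V} (hxy : x ≠ y) (j : ℕ)
    :
    w x * (occ w (j + 2) y - occ₂ w (j + 2) x y) = w y * (occ w (j + 2) x - occ₂ w (j + 2) x y) := by
  rw [occ_eq_left hxy, occ_eq_right hxy, occ₂_eq hxy]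
  ring

lemma occ₂_le_occ {w : V → ℝ} {x y : V} (hxy : x ≠ y) (j : ℕ)
    (hw : ∀ x, 0 < w x) : occ₂ w (j + 2) x y ≤ occ w (j + 2) x := by
  rw [occ_eq_left hxy, occ₂_eq hxy]
  have := mul_nonneg (hw x).le (esym_nonneg hw ((Finset.univ.erase x).erase y) (j + 1))
  exact div_le_div_of_nonneg_right (by linarith) (esym_nonneg hw _ _)

/-- Occupation numbers are negatively correlated: up to a positive factor the covariance is
`e_{n-2} e_n - e_{n-1}²`, with `e_i` the elementary symmetric polynomials of the other weights. -/
lemma occ₂_le_mul {w : V → ℝ} {x y : V} (hxy : x ≠ y) (j : ℕ)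
    (hw : ∀ x, 0 < w x) (hn : j + 2 ≤ Fintype.card V) :
    occ₂ w (j + 2) x y ≤ occ w (j + 2) x * occ w (j + 2) y := by
  have hZ : 0 < esym w Finset.univ (j + 2) := esym_pos hw (by simpa using hn)
  have hl := esym_logConcave hw ((Finset.univ.erase x).erase y) j j le_rfl
  have hc := mul_le_mul_of_nonneg_left hl (mul_pos (hw x) (hw y)).le
  rw [occ_eq_left hxy, occ_eq_right hxy, occ₂_eq hxy, div_mul_div_comm, div_le_div_iff₀ hZ
    (mul_pos hZ hZ), ← mul_assoc]
  refine mul_le_mul_of_nonneg_right ?_ hZ.le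
  rw [esym_univ_pair hxy]
  nlinarith

lemma occ_congr {w : V → ℝ} {x y : V} (hw : ∀ x, 0 < w x) (h : w x = w y) (j : ℕ) :
    occ w (j + 2) x = occ w (j + 2) y := by
  by_cases hxy : x = y
  · rw [hxy]
  · have := occ_exchange (w := w) hxy j
    rw [h] at this
    linarith [mul_left_cancel₀ (hw y).ne' this]

lemma occ₂_congr {w : V → ℝ} {x y z : V} (hx : z ≠ x) (hy : z ≠ y) (h : w x = w y) (j : ℕ) :
    occ₂ w (j + 2) z x = occ₂ w (j + 2) z y := by
  by_cases hxy : x = y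
  · rw [hxy]
  rw [occ₂_eq hx, occ₂_eq hy, h]
  suffices esym w ((Finset.univ.erase z).erase x) j = esym w ((Finset.univ.erase z).erase y) j by
    rw [this]
  rcases j with _ | j
  · simp [esym_zero]
  · rw [esym_erase w (x := y) (by simp [hy.symm, Ne.symm hxy]),
      esym_erase w (S := (Finset.univ.erase z).erase y) (x := x) (by simp [hx.symm, hxy]), h,
      Finset.erase_right_comm]

/-- The covariances of the occupation of `x` with all occupations add up to zero, and those with
other sites have the same sign; so they are small if each weight occurs often. -/
lemma occ_mul_sub_occ₂_le {w : V → ℝ} (hw : ∀ x, 0 < w x) {j : ℕ} (hn : j + 2 ≤ Fintype.card V)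
    {A : ℕ} (hA : 1 < A) {x y : V} (hxy : x ≠ y)
    (hcard : A ≤ (Finset.univ.filter fun z => w z = w y).card) :
    occ w (j + 2) x * occ w (j + 2) y - occ₂ w (j + 2) x y ≤ 1 / (A - 1) := by
  set c : V → ℝ := fun z => occ w (j + 2) x * occ w (j + 2) z - occ₂ w (j + 2) x z with hc
  have hsum : ∑ z, c z = 0 := by
    rw [hc, Finset.sum_sub_distrib, ← Finset.mul_sum, sum_occ hw hn, sum_occ₂]
    ring
  rw [← Finset.add_sum_erase _ _ (Finset.mem_univ x)] at hsum
  have hcx : -c x ≤ 1 := by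
    simp only [hc, occ₂_self]
    nlinarith [occ_nonneg hw (j + 2) x, occ_le_one hw (j + 2) x]
  set L := (Finset.univ.filter fun z => w z = w y).erase x
  have hL : (A : ℝ) - 1 ≤ L.card := by
    have h1 : A ≤ L.card + 1 := by
      have : _ ≤ L.card := Finset.pred_card_le_card_erase
      omega
    have h2 : (A : ℝ) ≤ L.card + 1 := by exact_mod_cast h1
    linarith
  have hnn : ∀ z ∈ Finset.univ.erase x, 0 ≤ c z := fun z hz =>
    sub_nonneg.2 (occ₂_le_mul (Finset.ne_of_mem_erase hz).symm j hw hn)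
  have hLc : ∑ z ∈ L, c z = L.card * c y := by
    rw [Finset.sum_congr rfl (g := fun _ => c y), Finset.sum_const, nsmul_eq_mul]
    intro z hz
    have hz' := Finset.mem_erase.1 hz
    simp only [hc]
    rw [occ_congr hw (Finset.mem_filter.1 hz'.2).2 j,
      occ₂_congr hz'.1.symm hxy (Finset.mem_filter.1 hz'.2).2 j]
  have hle : ∑ z ∈ L, c z ≤ ∑ z ∈ Finset.univ.erase x, c z :=
    Finset.sum_le_sum_of_subset_of_nonneg
      (Finset.erase_subset_erase x (Finset.filter_subset _ _)) fun z hz _ => hnn z hz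
  have hA' : (0 : ℝ) < A - 1 := by
    have : (1 : ℝ) < A := by exact_mod_cast hA
    linarith
  have hcy : 0 ≤ c y := hnn y (by simp [hxy.symm])
  rw [le_div_iff₀ hA']
  nlinarith [mul_le_mul_of_nonneg_right hL hcy]

lemma canonMean_linear (w : V → ℝ) (n : ℕ) (f : V → ℝ) :
    canonMean w n (fun T => ∑ x ∈ T, f x) = ∑ x, f x * occ w n x := by
  simp only [occ, ← canonMean_smul]
  rw [← canonMean_sum]
  exact canonMean_congr w n fun T _ => by simp

lemma canonMean_linear_sq (w : V → ℝ) (n : ℕ) (f : V → ℝ) :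
    canonMean w n (fun T => (∑ x ∈ T, f x) ^ 2) = ∑ x, ∑ y, f x * f y * occ₂ w n x y := by
  simp only [occ₂, ← canonMean_smul]
  simp only [← canonMean_sum]
  refine canonMean_congr w n fun T _ => ?_
  have h : ∀ x, ∑ y, f x * f y * (if x ∈ T ∧ y ∈ T then (1 : ℝ) else 0) =
      if x ∈ T then ∑ y ∈ T, f x * f y else 0 := by
    intro x
    by_cases hx : x ∈ T <;> simp [hx]
  rw [sq, Finset.sum_mul_sum, Finset.sum_congr rfl fun x _ => h x]
  simp

/-- A lower bound for the variance of a nonnegative linear statistic by the value it would have for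
independent occupation numbers, when `c` bounds the negative correlations. -/
lemma le_canonMean_variance {w : V → ℝ} (hw : ∀ x, 0 < w x) {n : ℕ} (hn : n ≤ Fintype.card V)
    {f : V → ℝ} (hf : ∀ x, 0 ≤ f x) {c : ℝ} (hc : 0 ≤ c)
    (hcov : ∀ x y, x ≠ y → f x ≠ 0 → f y ≠ 0 → occ w n x * occ w n y - occ₂ w n x y ≤ c) :
    ∑ x, f x ^ 2 * (occ w n x * (1 - occ w n x)) - c * (∑ x, f x) ^ 2 ≤
      canonMean w n (fun T => (∑ x ∈ T, f x - ∑ x, f x * occ w n x) ^ 2) := by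
  set a := ∑ x, f x * occ w n x with ha
  have h1 : canonMean w n (fun T => (∑ x ∈ T, f x - a) ^ 2) =
      ∑ x, ∑ y, f x * f y * occ₂ w n x y - a ^ 2 := by
    have : ∀ T : Finset V, (∑ x ∈ T, f x - a) ^ 2 =
        (∑ x ∈ T, f x) ^ 2 + ((-2 * a) * (∑ x ∈ T, f x) + a ^ 2) := fun T => by ring
    simp only [this]
    rw [canonMean_add, canonMean_add, canonMean_linear_sq, canonMean_smul, canonMean_linear,
      canonMean_const hw hn, ← ha]
    ring
  rw [h1, sq a, ha, Finset.sum_mul_sum, sq (∑ x, f x), Finset.sum_mul_sum, Finset.mul_sum,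
    ← Finset.sum_sub_distrib, ← Finset.sum_sub_distrib]
  refine Finset.sum_le_sum fun x _ => ?_
  rw [Finset.mul_sum, ← Finset.sum_sub_distrib, ← Finset.add_sum_erase _ _ (Finset.mem_univ x),
    ← Finset.add_sum_erase Finset.univ (fun y => f x * f y * occ₂ w n x y - _)
      (Finset.mem_univ x), occ₂_self]
  have h2 : -∑ y ∈ Finset.univ.erase x, c * (f x * f y) ≤ ∑ y ∈ Finset.univ.erase x,
      (f x * f y * occ₂ w n x y - f x * occ w n x * (f y * occ w n y)) := by
    rw [← Finset.sum_neg_distrib]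
    refine Finset.sum_le_sum fun y hy => ?_
    by_cases h : f x = 0 ∨ f y = 0
    · rcases h with h | h <;> simp [h]
    · push Not at h
      nlinarith [mul_le_mul_of_nonneg_left (hcov x y (Finset.ne_of_mem_erase hy).symm h.1 h.2)
        (mul_nonneg (hf x) (hf y))]
  nlinarith [mul_nonneg hc (mul_self_nonneg (f x))]

end CanonicalEnsemble

/-! ### The interface Hamiltonian as a sum of squares over bonds -/

section Hamiltonian

variable {Λ : Finset Site}

lemma at_mulVec (S : Matrix (Fin 2) (Fin 2) ℂ) (x : Λ) (φ : State Λ) (σ : Config Λ) :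
    (at_ S x *ᵥ φ) σ = ∑ s, S (σ x) s * φ (Function.update σ x s) := by
  simp only [Matrix.mulVec, dotProduct, at_, Matrix.of_apply, ite_mul, zero_mul]
  rw [← Finset.sum_filter]
  refine Finset.sum_nbij' (fun τ => τ x) (fun s => Function.update σ x s) ?_ ?_ ?_ ?_ ?_
  · intro τ _
    exact Finset.mem_univ _
  · intro s _
    simp only [Finset.mem_filter, Finset.mem_univ, true_and]
    intro y hy
    rw [Function.update_of_ne hy]
  · intro τ hτ
    simp only [Finset.mem_filter, Finset.mem_univ, true_and] at hτ
    funext y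
    by_cases hy : y = x
    · subst hy; simp
    · rw [Function.update_of_ne hy, hτ y hy]
  · intro s _
    simp
  · intro τ hτ
    simp only [Finset.mem_filter, Finset.mem_univ, true_and] at hτ
    congr 2
    funext y
    by_cases hy : y = x
    · subst hy; simp
    · rw [Function.update_of_ne hy, hτ y hy]

/-- The eigenvalue of `S³` in the basis state labelled by `s`. -/
def spinValue (s : Fin 2) : ℝ := if s = 0 then 1 / 2 else -1 / 2

lemma at_S3_mulVec (x : Λ) (φ : State Λ) (σ : Config Λ) :
    (at_ S3 x *ᵥ φ) σ = spinValue (σ x) * φ σ := by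
  rw [at_mulVec, Fin.sum_univ_two]
  have h : Function.update σ x (σ x) = σ := Function.update_eq_self x σ
  rcases Fin.exists_fin_two.1 ⟨σ x, rfl⟩ with h0 | h0 <;> rw [h0] at h ⊢ <;>
    simp [S3, spinValue, h]

lemma at_S3_mul_mulVec (x y : Λ) (φ : State Λ) (σ : Config Λ) :
    ((at_ S3 x * at_ S3 y) *ᵥ φ) σ = spinValue (σ x) * spinValue (σ y) * φ σ := by
  rw [← Matrix.mulVec_mulVec, at_S3_mulVec, at_S3_mulVec, mul_assoc]

/-- The configuration `σ` with the spins at `x` and `y` exchanged. -/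
def exchange (x y : Λ) (σ : Config Λ) : Config Λ := σ ∘ Equiv.swap x y

lemma exchange_exchange (x y : Λ) (σ : Config Λ) : exchange x y (exchange x y σ) = σ := by
  funext z
  simp [exchange]

lemma exchange_comm (x y : Λ) (σ : Config Λ) : exchange x y σ = exchange y x σ := by
  rw [exchange, exchange, Equiv.swap_comm]

lemma exchange_left (x y : Λ) (σ : Config Λ) : exchange x y σ x = σ y := by simp [exchange]

lemma exchange_right (x y : Λ) (σ : Config Λ) : exchange x y σ y = σ x := by simp [exchange]

lemma exchange_of_ne {x y z : Λ} (hx : z ≠ x) (hy : z ≠ y) (σ : Config Λ) :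
    exchange x y σ z = σ z := by
  simp [exchange, Equiv.swap_apply_of_ne_of_ne hx hy]

lemma update_update_eq_exchange {x y : Λ} (hxy : x ≠ y) (σ : Config Λ) :
    Function.update (Function.update σ x (σ y)) y (σ x) = exchange x y σ := by
  funext z
  by_cases hy : z = y
  · subst hy; simp [exchange_right]
  by_cases hx : z = x
  · subst hx; simp [exchange_left, hxy]
  · rw [Function.update_of_ne hy, Function.update_of_ne hx, exchange_of_ne hx hy]

/-- The transverse part of the interaction exchanges opposite spins. -/
lemma hopping_mulVec {x y : Λ} (hxy : x ≠ y) (φ : State Λ) (σ : Config Λ) :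
    ((at_ S1 x * at_ S1 y + at_ S2 x * at_ S2 y) *ᵥ φ) σ =
      if σ x = σ y then 0 else 1 / 2 * φ (exchange x y σ) := by
  have h := update_update_eq_exchange hxy σ
  rw [Matrix.add_mulVec, Pi.add_apply, ← Matrix.mulVec_mulVec, ← Matrix.mulVec_mulVec]
  simp only [at_mulVec, Fin.sum_univ_two, Function.update_of_ne hxy.symm]
  rcases Fin.exists_fin_two.1 ⟨σ x, rfl⟩ with hx | hx <;>
    rcases Fin.exists_fin_two.1 ⟨σ y, rfl⟩ with hy | hy <;>
    rw [hx, hy] at h ⊢ <;> simp [S1, S2, h] <;> ring_nf <;> simp [Complex.I_sq] <;> ring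

/-- `y` is a nearest neighbour of `x` in the next 111 plane. -/
def IsAbove (x y : Site) : Prop := Neighbour x y ∧ level y = level x + 1

instance (x y : Site) : Decidable (IsAbove x y) := by unfold IsAbove; infer_instance

lemma neighbour_comm {x y : Site} : Neighbour x y ↔ Neighbour y x := by
  unfold Neighbour
  simp only [abs_sub_comm]

lemma Neighbour.level_eq {x y : Site} (h : Neighbour x y) :
    level y = level x + 1 ∨ level x = level y + 1 := by
  simp only [Neighbour, level, Fin.sum_univ_three] at *
  rcases abs_cases (x 0 - y 0) with h0 | h0 <;> rcases abs_cases (x 1 - y 1) with h1 | h1 <;>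
    rcases abs_cases (x 2 - y 2) with h2 | h2 <;> omega

lemma Neighbour.ne {x y : Site} (h : Neighbour x y) : x ≠ y := by
  rintro rfl
  simp [Neighbour] at h

lemma IsAbove.ne {x y : Λ} (h : IsAbove x y) : x ≠ y := fun e => h.1.ne (congrArg _ e)

/-- A sum over ordered pairs of neighbours as a sum over bonds, oriented upwards. -/
lemma sum_neighbour (F : Λ → Λ → ℂ) :
    ∑ x : Λ, ∑ y : Λ, (if Neighbour x y then F x y else 0) =
      ∑ x : Λ, ∑ y : Λ, if IsAbove x y then F x y + F y x else 0 := by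
  have h : ∀ x y : Λ, (if Neighbour x y then F x y else 0) =
      (if IsAbove x y then F x y else 0) + (if IsAbove y x then F x y else 0) := by
    intro x y
    by_cases hn : Neighbour (x : Site) y
    · rcases hn.level_eq with h | h
      · rw [if_pos hn, if_pos ⟨hn, h⟩, if_neg fun h' => by have := h'.2; omega, add_zero]
      · rw [if_pos hn, if_neg fun h' => by have := h'.2; omega, if_pos ⟨neighbour_comm.1 hn, h⟩,
          zero_add]
    · rw [if_neg hn, if_neg fun h => hn h.1, if_neg fun h => hn (neighbour_comm.1 h.1), add_zero]
  simp only [h, Finset.sum_add_distrib]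
  rw [Finset.sum_comm (f := fun x y : Λ => if IsAbove (y : Site) x then F x y else 0)]
  rw [← Finset.sum_add_distrib]
  refine Finset.sum_congr rfl fun x _ => ?_
  rw [← Finset.sum_add_distrib]
  refine Finset.sum_congr rfl fun y _ => ?_
  split_ifs <;> simp

/-- The action of `1 + q ^ 2` times the projection onto `↑↓ - q ↓↑` on the bond from `x` up to `y`,
in the standard basis. -/
def bondTerm (q : ℝ) (x y : Λ) (φ : State Λ) (σ : Config Λ) : ℂ :=
  if σ x = 0 ∧ σ y = 1 then φ σ - q * φ (exchange x y σ)
  else if σ x = 1 ∧ σ y = 0 then q ^ 2 * φ σ - q * φ (exchange x y σ) else 0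

lemma fieldStrength_eq {q : ℝ} (hq : q ∈ Set.Ioo (0 : ℝ) 1) :
    fieldStrength ((q + q⁻¹) / 2) = 1 / 2 * ((1 - q ^ 2) / (1 + q ^ 2)) := by
  have hq0 : q ≠ 0 := hq.1.ne'
  have h : 1 - 1 / ((q + q⁻¹) / 2) ^ 2 = ((1 - q ^ 2) / (1 + q ^ 2)) ^ 2 := by
    have : 1 + q ^ 2 ≠ 0 := by positivity
    have h' : q + q⁻¹ = (1 + q ^ 2) / q := by field_simp; ring
    rw [h']
    field_simp
    ring
  rw [fieldStrength, h, Real.sqrt_sq]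
  exact div_nonneg (by nlinarith [hq.1, hq.2]) (by positivity)

lemma interfaceHamiltonian_mulVec {q : ℝ} (hq : q ∈ Set.Ioo (0 : ℝ) 1) (φ : State Λ)
    (σ : Config Λ) :
    (interfaceHamiltonian ((q + q⁻¹) / 2) Λ *ᵥ φ) σ =
      ∑ x : Λ, ∑ y : Λ, if IsAbove x y then
        -(1 / 2) * φ σ + 2 / (1 + q ^ 2) * bondTerm q x y φ σ else 0 := by
  have hq0 : (q : ℂ) ≠ 0 := by exact_mod_cast hq.1.ne'
  have hq1 : (1 + q ^ 2 : ℂ) ≠ 0 := by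
    have : (1 + q ^ 2 : ℝ) ≠ 0 := by positivity
    exact_mod_cast this
  have hΔ : (((1 / ((q + q⁻¹) / 2) : ℝ)) : ℂ) = 2 * q / (1 + q ^ 2) := by
    have h : (1 / ((q + q⁻¹) / 2) : ℝ) = 2 * q / (1 + q ^ 2) := by
      have := hq.1.ne'
      have h' : q + q⁻¹ = (1 + q ^ 2) / q := by field_simp; ring
      rw [h']
      field_simp
    rw [h]
    push_cast
    ring
  have hfield : ((∑ x : Λ, ((2 * fieldStrength ((q + q⁻¹) / 2) * (boundaryDefect x : ℝ) : ℝ) : ℂ) •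
      at_ S3 x) *ᵥ φ) σ = ∑ x : Λ, ∑ y : Λ, if Neighbour x y then
        (1 - q ^ 2) / (1 + q ^ 2) * ((level y - level x : ℤ) : ℂ) * spinValue (σ x) * φ σ
        else 0 := by
    rw [Matrix.sum_mulVec, Finset.sum_apply]
    refine Finset.sum_congr rfl fun x _ => ?_
    rw [Matrix.smul_mulVec, Pi.smul_apply, at_S3_mulVec, smul_eq_mul, fieldStrength_eq hq,
      boundaryDefect]
    push_cast
    rw [Finset.mul_sum, Finset.sum_mul]
    refine Finset.sum_congr rfl fun y _ => ?_
    split_ifs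
    · push_cast; ring
    · simp
  have hham : (hamiltonian ((q + q⁻¹) / 2) Λ *ᵥ φ) σ = ∑ x : Λ, ∑ y : Λ, if Neighbour x y then
      -(2 * q / (1 + q ^ 2) * (if σ x = σ y then 0 else 1 / 2 * φ (exchange x y σ)) +
        spinValue (σ x) * spinValue (σ y) * φ σ) else 0 := by
    rw [hamiltonian, Matrix.neg_mulVec, Pi.neg_apply, Matrix.sum_mulVec, Finset.sum_apply,
      ← Finset.sum_neg_distrib]
    refine Finset.sum_congr rfl fun x _ => ?_
    rw [Matrix.sum_mulVec, Finset.sum_apply, ← Finset.sum_neg_distrib]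
    refine Finset.sum_congr rfl fun y _ => ?_
    by_cases h : Neighbour (x : Site) y
    · rw [if_pos h, if_pos h, Matrix.add_mulVec, Pi.add_apply, Matrix.smul_mulVec, Pi.smul_apply, smul_eq_mul,
        hopping_mulVec (fun e => h.ne (congrArg _ e)), at_S3_mul_mulVec, hΔ]
    · rw [if_neg h, if_neg h, Matrix.zero_mulVec, Pi.zero_apply, neg_zero]
  rw [interfaceHamiltonian, Matrix.add_mulVec, Pi.add_apply, hfield, hham, sum_neighbour,
    sum_neighbour, ← Finset.sum_add_distrib]
  refine Finset.sum_congr rfl fun x _ => ?_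
  rw [← Finset.sum_add_distrib]
  refine Finset.sum_congr rfl fun y _ => ?_
  by_cases h : IsAbove (x : Site) y
  · rw [if_pos h, if_pos h, if_pos h, exchange_comm y x, show level (y : Site) - level (x : Site) = 1 by rw [h.2]; ring,
      show level (x : Site) - level (y : Site) = -1 by rw [h.2]; ring, bondTerm]
    rcases Fin.exists_fin_two.1 ⟨σ x, rfl⟩ with hx | hx <;>
      rcases Fin.exists_fin_two.1 ⟨σ y, rfl⟩ with hy | hy <;>
      simp [hx, hy, spinValue] <;> field_simp <;> ring
  · rw [if_neg h, if_neg h, if_neg h, add_zero]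

/-- The number of bonds of `Λ`. -/
def bondCount (Λ : Finset Site) : ℕ := ∑ x : Λ, ∑ y : Λ, if IsAbove x y then 1 else 0

/-- `1 + q ^ 2` times the expectation of the projection onto `↑↓ - q ↓↑` on the bond from `x` up
to `y`. -/
def bondSquare (q : ℝ) (φ : State Λ) (x y : Λ) : ℝ :=
  ∑ σ : Config Λ, if σ x = 0 ∧ σ y = 1 then ‖φ σ - q * φ (exchange x y σ)‖ ^ 2 else 0

lemma bondSquare_nonneg (q : ℝ) (φ : State Λ) (x y : Λ) : 0 ≤ bondSquare q φ x y :=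
  Finset.sum_nonneg fun σ _ => by split_ifs <;> positivity

/-- The sum of squares which is, up to a constant factor, the energy above the ground state. -/
def bondEnergy (q : ℝ) (φ : State Λ) : ℝ :=
  ∑ x : Λ, ∑ y : Λ, if IsAbove x y then bondSquare q φ x y else 0

lemma bondEnergy_nonneg (q : ℝ) (φ : State Λ) : 0 ≤ bondEnergy q φ := by
  refine Finset.sum_nonneg fun x _ => Finset.sum_nonneg fun y _ => ?_
  split_ifs
  · exact bondSquare_nonneg q φ x y
  · exact le_rfl

lemma sum_exchange {x y : Λ} (F : Config Λ → ℂ) :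
    ∑ σ, F (exchange x y σ) = ∑ σ, F σ :=
  Equiv.sum_comp (Function.Involutive.toPerm _ (exchange_exchange x y)) F

/-- The configurations with `↑↓` on the bond and, after an exchange, those with `↓↑` contribute to
the same square. -/
lemma sum_star_mul_bondTerm (q : ℝ) (x y : Λ) (φ : State Λ) :
    ∑ σ, star (φ σ) * bondTerm q x y φ σ =
      (bondSquare q φ x y : ℂ) := by
  rw [bondSquare]
  have h1 : ∀ σ, star (φ σ) * bondTerm q x y φ σ =
      (if σ x = 0 ∧ σ y = 1 then star (φ σ) * (φ σ - q * φ (exchange x y σ)) else 0) +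
      (if σ x = 1 ∧ σ y = 0 then star (φ σ) * (q ^ 2 * φ σ - q * φ (exchange x y σ)) else 0) := by
    intro σ
    unfold bondTerm
    by_cases h : σ x = 0 ∧ σ y = 1
    · simp [h.1, h.2]
    · by_cases h' : σ x = 1 ∧ σ y = 0
      · simp [h'.1, h'.2]
      · simp [h, h']
  simp only [h1]
  rw [Finset.sum_add_distrib, ← sum_exchange (x := x) (y := y) (fun σ =>
    if σ x = 1 ∧ σ y = 0 then star (φ σ) * (q ^ 2 * φ σ - q * φ (exchange x y σ)) else 0),
    ← Finset.sum_add_distrib]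
  push_cast
  refine Finset.sum_congr rfl fun σ _ => ?_
  rw [exchange_left, exchange_right, exchange_exchange]
  simp only [and_comm (a := σ y = 1)]
  split_ifs
  · have h2 : ∀ z : ℂ, (‖z‖ : ℂ) ^ 2 = star z * z := fun z => by
      rw [Complex.star_def, ← Complex.normSq_eq_conj_mul_self, Complex.normSq_eq_norm_sq]
      push_cast
      rfl
    rw [Complex.ofReal_pow, h2]
    simp only [star_sub, star_mul', Complex.star_def, Complex.conj_ofReal]
    ring
  · simp

lemma star_dotProduct_self (φ : State Λ) : star φ ⬝ᵥ φ = ((∑ σ, ‖φ σ‖ ^ 2 : ℝ) : ℂ) := by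
  simp only [dotProduct, Pi.star_apply]
  push_cast
  refine Finset.sum_congr rfl fun σ _ => ?_
  rw [Complex.star_def, ← Complex.normSq_eq_conj_mul_self, Complex.normSq_eq_norm_sq]
  push_cast
  rfl

lemma norm_sq_pos {φ : State Λ} (hφ : φ ≠ 0) : 0 < ∑ σ, ‖φ σ‖ ^ 2 := by
  obtain ⟨σ, hσ⟩ := Function.ne_iff.1 hφ
  exact Finset.sum_pos' (fun _ _ => by positivity)
    ⟨σ, Finset.mem_univ σ, by have := norm_pos_iff.2 hσ; positivity⟩

lemma star_dotProduct_interfaceHamiltonian {q : ℝ} (hq : q ∈ Set.Ioo (0 : ℝ) 1) (φ : State Λ) :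
    star φ ⬝ᵥ (interfaceHamiltonian ((q + q⁻¹) / 2) Λ *ᵥ φ) =
      ((-(1 / 2) * bondCount Λ * ∑ σ, ‖φ σ‖ ^ 2 + 2 / (1 + q ^ 2) * bondEnergy q φ : ℝ) : ℂ) := by
  have h : star φ ⬝ᵥ (interfaceHamiltonian ((q + q⁻¹) / 2) Λ *ᵥ φ) =
      ∑ x : Λ, ∑ y : Λ, if IsAbove x y then -(1 / 2) * (star φ ⬝ᵥ φ) +
        2 / (1 + q ^ 2) * ∑ σ, star (φ σ) * bondTerm q x y φ σ else 0 := by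
    simp only [dotProduct, interfaceHamiltonian_mulVec hq, Finset.mul_sum, Pi.star_apply]
    rw [Finset.sum_comm]
    refine Finset.sum_congr rfl fun x _ => ?_
    rw [Finset.sum_comm]
    refine Finset.sum_congr rfl fun y _ => ?_
    split_ifs
    · rw [← Finset.sum_add_distrib]
      exact Finset.sum_congr rfl fun σ _ => by ring
    · simp
  have h' : -(1 / 2) * bondCount Λ * ∑ σ, ‖φ σ‖ ^ 2 + 2 / (1 + q ^ 2) * bondEnergy q φ =
      ∑ x : Λ, ∑ y : Λ, if IsAbove x y then -(1 / 2) * (∑ σ, ‖φ σ‖ ^ 2) +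
        2 / (1 + q ^ 2) * bondSquare q φ x y else 0 := by
    generalize ∑ σ, ‖φ σ‖ ^ 2 = a
    rw [bondCount, bondEnergy]
    simp only [Nat.cast_sum, Finset.mul_sum, Finset.sum_mul, ← Finset.sum_add_distrib]
    refine Finset.sum_congr rfl fun x _ => Finset.sum_congr rfl fun y _ => ?_
    split_ifs
    · push_cast; ring
    · simp
  rw [h, h', star_dotProduct_self]
  simp only [sum_star_mul_bondTerm]
  generalize ∑ σ, ‖φ σ‖ ^ 2 = a
  push_cast
  refine Finset.sum_congr rfl fun x _ => Finset.sum_congr rfl fun y _ => ?_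
  split_ifs
  · push_cast; rfl
  · simp

/-- The energy is a constant, the same for all vectors, plus a sum of squares. -/
lemma energy_eq {q : ℝ} (hq : q ∈ Set.Ioo (0 : ℝ) 1) {φ : State Λ} (hφ : φ ≠ 0) :
    energy (interfaceHamiltonian ((q + q⁻¹) / 2) Λ) φ =
      -(1 / 2) * bondCount Λ + 2 / (1 + q ^ 2) * (bondEnergy q φ / ∑ σ, ‖φ σ‖ ^ 2) := by
  have h := (norm_sq_pos hφ).ne'
  rw [energy, star_dotProduct_interfaceHamiltonian hq, star_dotProduct_self, Complex.ofReal_re,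
    Complex.ofReal_re, add_div, mul_div_cancel_right₀ _ h, mul_div_assoc]

end Hamiltonian

/-! ### Ground states and their diagonal excitations -/

section GroundState

variable {Λ : Finset Site}

/-- The sites of the down spins of a configuration. -/
def downSet (σ : Config Λ) : Finset Λ := Finset.univ.filter fun x => σ x = 1

lemma mem_downSet {σ : Config Λ} {x : Λ} : x ∈ downSet σ ↔ σ x = 1 := by simp [downSet]

/-- The amplitude `∏ q ^ level x`, over the down spins, of a configuration in the interface ground
states. -/
def amplitude (q : ℝ) (σ : Config Λ) : ℝ := ∏ x ∈ downSet σ, q ^ level x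

/-- The canonical interface ground state with `n` down spins. -/
def groundVector (q : ℝ) (n : ℕ) : State Λ :=
  fun σ => if (downSet σ).card = n then (amplitude q σ : ℂ) else 0

lemma amplitude_pos {q : ℝ} (hq : 0 < q) (σ : Config Λ) : 0 < amplitude q σ :=
  Finset.prod_pos fun _ _ => zpow_pos hq _

lemma downSet_exchange {x y : Λ} {σ : Config Λ} (hx : σ x = 0) (hy : σ y = 1) :
    downSet (exchange x y σ) = insert x ((downSet σ).erase y) := by
  ext z
  rw [mem_downSet, Finset.mem_insert, Finset.mem_erase, mem_downSet]
  by_cases hzx : z = x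
  · subst hzx; simp [exchange_left, hy]
  · by_cases hzy : z = y
    · subst hzy; simp [exchange_right, hx, hzx]
    · simp [exchange_of_ne hzx hzy, hzx, hzy]

lemma card_downSet_exchange (x y : Λ) (σ : Config Λ) :
    (downSet (exchange x y σ)).card = (downSet σ).card := by
  refine Finset.card_bij' (fun z _ => Equiv.swap x y z) (fun z _ => Equiv.swap x y z) ?_ ?_ ?_ ?_ <;>
    intro z hz <;> simp_all [mem_downSet, exchange]

lemma sum_downSet_exchange {x y : Λ} {σ : Config Λ} (hx : σ x = 0) (hy : σ y = 1) (f : Λ → ℝ) :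
    ∑ z ∈ downSet σ, f z - ∑ z ∈ downSet (exchange x y σ), f z = f y - f x := by
  have hx' : x ∉ (downSet σ).erase y := by simp [mem_downSet, hx]
  rw [downSet_exchange hx hy, Finset.sum_insert hx',
    ← Finset.add_sum_erase _ _ (mem_downSet.2 hy)]
  ring

lemma amplitude_exchange {q : ℝ} (hq : 0 < q) {x y : Λ} (h : IsAbove (x : Site) y) {σ : Config Λ}
    (hx : σ x = 0) (hy : σ y = 1) : amplitude q σ = q * amplitude q (exchange x y σ) := by
  have hx' : x ∉ (downSet σ).erase y := by simp [mem_downSet, hx]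
  rw [amplitude, amplitude, downSet_exchange hx hy, Finset.prod_insert hx',
    ← Finset.mul_prod_erase _ _ (mem_downSet.2 hy), h.2, zpow_add_one₀ hq.ne']
  ring

lemma groundVector_exchange {q : ℝ} (hq : 0 < q) (n : ℕ) {x y : Λ} (h : IsAbove (x : Site) y)
    {σ : Config Λ} (hx : σ x = 0) (hy : σ y = 1) :
    groundVector q n σ = q * groundVector q n (exchange x y σ) := by
  rw [groundVector, groundVector, card_downSet_exchange, amplitude_exchange hq h hx hy]
  split_ifs
  · push_cast; rfl
  · simp

/-- Configurations correspond to the sets of their down spins. -/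
def downSetEquiv : Config Λ ≃ Finset Λ where
  toFun := downSet
  invFun T x := if x ∈ T then 1 else 0
  left_inv σ := by
    funext x
    rcases Fin.exists_fin_two.1 ⟨σ x, rfl⟩ with h | h <;> simp [mem_downSet, h]
  right_inv T := by
    ext x
    simp [mem_downSet]

lemma exists_card_downSet {n : ℕ} (hn : n ≤ Fintype.card Λ) :
    ∃ σ : Config Λ, (downSet σ).card = n := by
  obtain ⟨T, -, hT⟩ := Finset.exists_subset_card_eq (s := (Finset.univ : Finset Λ)) (n := n)
    (by simpa using hn)
  exact ⟨downSetEquiv.symm T, by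
    rw [← hT]; exact congrArg Finset.card (downSetEquiv.apply_symm_apply T)⟩

lemma groundVector_ne_zero {q : ℝ} (hq : 0 < q) {n : ℕ} (hn : n ≤ Fintype.card Λ) :
    (groundVector q n : State Λ) ≠ 0 := by
  obtain ⟨σ, hσ⟩ := exists_card_downSet hn
  refine Function.ne_iff.2 ⟨σ, ?_⟩
  simp [groundVector, hσ, (amplitude_pos hq σ).ne']

lemma groundVector_mem_sector (q : ℝ) (n : ℕ) : (groundVector q n : State Λ) ∈ sector Λ n := by
  intro σ hσ
  by_contra h
  exact hσ (if_neg h)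

lemma bondEnergy_groundVector {q : ℝ} (hq : 0 < q) (n : ℕ) :
    bondEnergy q (groundVector q n : State Λ) = 0 := by
  refine Finset.sum_eq_zero fun x _ => Finset.sum_eq_zero fun y _ => ?_
  split_ifs with h
  · refine Finset.sum_eq_zero fun σ _ => ?_
    split_ifs with hσ
    · rw [groundVector_exchange hq n h hσ.1 hσ.2, sub_self, norm_zero, zero_pow two_ne_zero]
    · rfl
  · rfl

lemma eq_mul_exchange_of_bondEnergy_eq_zero {q : ℝ} {φ : State Λ} (hφ : bondEnergy q φ = 0)
    {x y : Λ} (h : IsAbove (x : Site) y) {σ : Config Λ} (hx : σ x = 0) (hy : σ y = 1) :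
    φ σ = q * φ (exchange x y σ) := by
  have hnn : ∀ x y : Λ, 0 ≤ if IsAbove (x : Site) y then bondSquare q φ x y else 0 := fun x y => by
    split_ifs
    · exact bondSquare_nonneg q φ x y
    · exact le_rfl
  have h1 := (Finset.sum_eq_zero_iff_of_nonneg fun x _ =>
    Finset.sum_nonneg fun y _ => hnn x y).1 hφ x (Finset.mem_univ x)
  have h2 := (Finset.sum_eq_zero_iff_of_nonneg fun y _ => hnn x y).1 h1 y (Finset.mem_univ y)
  rw [if_pos h, bondSquare] at h2
  have h3 := (Finset.sum_eq_zero_iff_of_nonneg fun σ _ => by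
    split_ifs <;> positivity).1 h2 σ (Finset.mem_univ σ)
  rw [if_pos ⟨hx, hy⟩] at h3
  exact sub_eq_zero.1 (norm_eq_zero.1 (pow_eq_zero_iff two_ne_zero |>.1 h3))

/-- A function on configurations that is invariant under the exchange of the spins of neighbours
depends only on the number of down spins, since the transpositions along the edges of a connected
graph generate the symmetric group. -/
lemma eq_of_forall_exchange (hΛ : (latticeGraph.induce (Λ : Set Site)).Connected)
    {g : Config Λ → ℂ}
    (hg : ∀ (x y : Λ), IsAbove (x : Site) y → ∀ σ, g (exchange x y σ) = g σ)
    {σ τ : Config Λ} (hστ : (downSet σ).card = (downSet τ).card) : g σ = g τ := by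
  have hswap : ∀ x y : Λ, ∀ σ : Config Λ, g (σ ∘ Equiv.swap x y) = g σ := by
    intro x y
    obtain ⟨p⟩ := hΛ.preconnected x y
    induction p with
    | nil => intro σ; simp
    | @cons x y z hadj p ih =>
      have hxy : ∀ σ : Config Λ, g (σ ∘ Equiv.swap x y) = g σ := by
        intro σ
        have hn : Neighbour (x : Site) y := hadj
        rcases hn.level_eq with h | h
        · exact hg x y ⟨hn, h⟩ σ
        · rw [Equiv.swap_comm]
          exact hg y x ⟨neighbour_comm.1 hn, h⟩ σ
      intro σ
      by_cases hxz : x = z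
      · subst hxz; simp
      by_cases hyz : y = z
      · subst hyz; exact hxy σ
      have h : Equiv.swap x z = Equiv.swap y x * Equiv.swap z y * Equiv.swap y x :=
        (Equiv.swap_mul_swap_mul_swap (Ne.symm hyz) (Ne.symm hxz)).symm
      rw [h, Equiv.Perm.coe_mul, Equiv.Perm.coe_mul, ← Function.comp_assoc, ← Function.comp_assoc,
        Equiv.swap_comm y x, Equiv.swap_comm z y, hxy, ih, hxy]
  have hperm : ∀ e : Equiv.Perm Λ, ∀ σ : Config Λ, g (σ ∘ e) = g σ := by
    intro e
    refine Equiv.Perm.swap_induction_on (motive := fun e => ∀ σ : Config Λ, g (σ ∘ e) = g σ) e ?_ ?_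
    · intro σ; rfl
    · intro f x y _ ih σ
      rw [Equiv.Perm.coe_mul, ← Function.comp_assoc, ih, hswap]
  have hcard : Fintype.card {x // τ x = 1} = Fintype.card {x // σ x = 1} := by
    rw [Fintype.card_subtype, Fintype.card_subtype]
    exact hστ.symm
  set e := (Fintype.equivOfCardEq hcard).extendSubtype with he
  have : σ ∘ e = τ := by
    funext x
    by_cases hx : τ x = 1
    · rw [hx]
      exact (Fintype.equivOfCardEq hcard).extendSubtype_mem x hx
    · have h := (Fintype.equivOfCardEq hcard).extendSubtype_not_mem x hx
      have h' : (σ ∘ e) x ≠ 1 := h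
      omega
  rw [← this, hperm]

lemma isGroundState_groundVector {q : ℝ} (hq : q ∈ Set.Ioo (0 : ℝ) 1) {n : ℕ}
    (hn : n ≤ Fintype.card Λ) :
    IsGroundState ((q + q⁻¹) / 2) n (groundVector q n : State Λ) := by
  refine ⟨groundVector_mem_sector q n, groundVector_ne_zero hq.1 hn, fun φ _ hφ => ?_⟩
  rw [energy_eq hq hφ, energy_eq hq (groundVector_ne_zero hq.1 hn), bondEnergy_groundVector hq.1,
    zero_div, mul_zero, add_zero]
  have := div_nonneg (bondEnergy_nonneg q φ) (norm_sq_pos hφ).le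
  have h2 : 0 ≤ 2 / (1 + q ^ 2) := by positivity
  linarith [mul_nonneg h2 this]

/-- In a connected volume the canonical ground state is unique up to a factor. -/
lemma IsGroundState.eq_smul {q : ℝ} (hq : q ∈ Set.Ioo (0 : ℝ) 1) {n : ℕ}
    (hn : n ≤ Fintype.card Λ) (hΛ : (latticeGraph.induce (Λ : Set Site)).Connected) {ψ : State Λ}
    (hψ : IsGroundState ((q + q⁻¹) / 2) n ψ) : ∃ c : ℂ, c ≠ 0 ∧ ψ = c • groundVector q n := by
  obtain ⟨hsec, hne, hmin⟩ := hψ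
  have hE : bondEnergy q ψ = 0 := by
    have h := hmin _ (groundVector_mem_sector q n) (groundVector_ne_zero hq.1 hn)
    rw [energy_eq hq hne, energy_eq hq (groundVector_ne_zero hq.1 hn),
      bondEnergy_groundVector hq.1, zero_div, mul_zero, add_zero] at h
    have h2 : 0 < 2 / (1 + q ^ 2) := by positivity
    have h3 : bondEnergy q ψ / ∑ σ, ‖ψ σ‖ ^ 2 ≤ 0 := by
      by_contra h4
      push Not at h4
      linarith [mul_pos h2 h4]
    refine le_antisymm ?_ (bondEnergy_nonneg q ψ)
    by_contra h4
    push Not at h4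
    linarith [div_pos h4 (norm_sq_pos hne)]
  -- The ratio to `groundVector` is invariant under exchanges along bonds.
  have hamp : ∀ σ : Config Λ, (amplitude q σ : ℂ) ≠ 0 := fun σ => by
    exact_mod_cast (amplitude_pos hq.1 σ).ne'
  have hq0 : (q : ℂ) ≠ 0 := by exact_mod_cast hq.1.ne'
  have hstep : ∀ x y : Λ, IsAbove (x : Site) y → ∀ σ : Config Λ, σ x = 0 → σ y = 1 →
      ψ (exchange x y σ) / amplitude q (exchange x y σ) = ψ σ / amplitude q σ := by
    intro x y h σ hx hy
    rw [eq_mul_exchange_of_bondEnergy_eq_zero hE h hx hy, amplitude_exchange hq.1 h hx hy]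
    push_cast
    rw [mul_div_mul_left _ _ hq0]
  have hconst : ∀ x y : Λ, IsAbove (x : Site) y → ∀ σ : Config Λ,
      ψ (exchange x y σ) / amplitude q (exchange x y σ) = ψ σ / amplitude q σ := by
    intro x y h σ
    by_cases hxy : σ x = σ y
    · have : exchange x y σ = σ := by
        funext z
        by_cases hzx : z = x
        · rw [hzx, exchange_left, hxy]
        · by_cases hzy : z = y
          · rw [hzy, exchange_right, hxy]
          · exact exchange_of_ne hzx hzy σ
      rw [this]
    · rcases Fin.exists_fin_two.1 ⟨σ x, rfl⟩ with hx | hx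
      · exact hstep x y h σ hx (by omega)
      · have := hstep x y h (exchange x y σ) (by rw [exchange_left]; omega)
          (by rw [exchange_right, hx])
        rw [exchange_exchange] at this
        exact this.symm
  obtain ⟨σ₀, hσ₀⟩ := exists_card_downSet hn
  have heq : ψ = (ψ σ₀ / amplitude q σ₀) • groundVector q n := by
    funext σ
    rw [Pi.smul_apply, smul_eq_mul, groundVector]
    by_cases hσ : (downSet σ).card = n
    · have h : ψ σ₀ / amplitude q σ₀ = ψ σ / amplitude q σ :=
        eq_of_forall_exchange hΛ (g := fun σ => ψ σ / amplitude q σ) hconst (hσ₀.trans hσ.symm)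
      rw [if_pos hσ, h, div_mul_cancel₀ _ (hamp σ)]
    · rw [if_neg hσ, mul_zero]
      by_contra h
      exact hσ (hsec σ h)
  refine ⟨_, ?_, heq⟩
  intro h
  rw [h, zero_smul] at heq
  exact hne heq

end GroundState

section Excitation

variable {Λ : Finset Site}

/-- The weights of the canonical ensemble of the down spins: squared amplitudes. -/
def weight (q : ℝ) (x : Λ) : ℝ := (q ^ level x) ^ 2

lemma weight_pos {q : ℝ} (hq : 0 < q) (x : Λ) : 0 < weight q x :=
  pow_pos (zpow_pos hq _) 2

/-- Expectations in the ground state of functions of the configuration are canonical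
expectations. -/
lemma sum_norm_sq_groundVector {q : ℝ} (hq : 0 < q) {n : ℕ} (hn : n ≤ Fintype.card Λ)
    (G : Finset Λ → ℝ) :
    ∑ σ : Config Λ, ‖groundVector q n σ‖ ^ 2 * G (downSet σ) =
      esym (weight q : Λ → ℝ) Finset.univ n * canonMean (weight q : Λ → ℝ) n G := by
  have hZ : 0 < esym (weight q : Λ → ℝ) Finset.univ n :=
    esym_pos (weight_pos hq) (by simpa using hn)
  rw [canonMean, mul_div_cancel₀ _ hZ.ne']
  have h : ∀ σ : Config Λ, ‖groundVector q n σ‖ ^ 2 * G (downSet σ) =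
      (fun T : Finset Λ => if T.card = n then (∏ x ∈ T, weight q x) * G T else 0)
        (downSetEquiv σ) := by
    intro σ
    change _ = if (downSet σ).card = n then _ else _
    rw [groundVector]
    split_ifs
    · rw [Complex.norm_real, Real.norm_eq_abs, sq_abs, amplitude, ← Finset.prod_pow]
      rfl
    · simp
  rw [Finset.sum_congr rfl fun σ _ => h σ, Equiv.sum_comp (M := ℝ) downSetEquiv
    (fun T : Finset Λ => if T.card = n then (∏ x ∈ T, weight q x) * G T else 0),
    ← Finset.sum_filter]
  refine Finset.sum_congr ?_ fun _ _ => rfl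
  ext T
  simp [Finset.mem_powersetCard]

/-- Multiplication by a real function of the set of down spins. -/
def diagonalObservable (F : Finset Λ → ℝ) : Observable Λ :=
  Matrix.diagonal fun σ => (F (downSet σ) : ℂ)

lemma diagonalObservable_mulVec (F : Finset Λ → ℝ) (ψ : State Λ) (σ : Config Λ) :
    (diagonalObservable F *ᵥ ψ) σ = F (downSet σ) * ψ σ :=
  Matrix.mulVec_diagonal _ _ _

lemma at_S3_eq_diagonal (x : Λ) :
    at_ S3 x = Matrix.diagonal fun σ => (spinValue (σ x) : ℂ) := by
  refine Matrix.ext_of_mulVec_single fun τ => ?_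
  funext σ
  rw [at_S3_mulVec, Matrix.mulVec_diagonal]

lemma commute_diagonalObservable_totalS3 (F : Finset Λ → ℝ) :
    Commute (diagonalObservable F) (totalS3 Λ) := by
  refine Commute.sum_right _ _ _ fun x _ => ?_
  rw [at_S3_eq_diagonal, diagonalObservable, Commute, SemiconjBy, Matrix.diagonal_mul_diagonal,
    Matrix.diagonal_mul_diagonal]
  simp only [mul_comm]

lemma isLocalizedIn_diagonalObservable {f : Site → ℝ} {S : Set Site} (hf : ∀ x ∉ S, f x = 0)
    (a : ℝ) :
    IsLocalizedIn (diagonalObservable fun T : Finset Λ => ∑ x ∈ T, f x - a) S := by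
  constructor
  · rintro σ τ ⟨x, -, hx⟩
    exact Matrix.diagonal_apply_ne _ fun h => hx (congrFun h x)
  · intro σ τ σ' τ' h h' hS
    by_cases he : σ = τ
    · subst he
      have he' : σ' = τ' := by
        funext x
        by_cases hx : (x : Site) ∈ S
        · rw [← (hS x hx).1, ← (hS x hx).2]
        · exact h' x hx
      subst he'
      rw [diagonalObservable, Matrix.diagonal_apply_eq, Matrix.diagonal_apply_eq]
      congr 2
      rw [downSet, downSet, Finset.sum_filter, Finset.sum_filter]
      refine Finset.sum_congr rfl fun x _ => ?_
      by_cases hx : (x : Site) ∈ S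
      · rw [(hS x hx).1]
      · rw [hf x hx, ite_self, ite_self]
    · have he' : σ' ≠ τ' := by
        rintro rfl
        refine he (funext fun x => ?_)
        by_cases hx : (x : Site) ∈ S
        · rw [(hS x hx).1, (hS x hx).2]
        · exact h x hx
      rw [diagonalObservable, Matrix.diagonal_apply_ne _ he, Matrix.diagonal_apply_ne _ he']

/-- The Dirichlet form, for exchanges of a hole with a particle just above it, of the statistic
`∑ f x` over the down spins. -/
def dirichletForm (q : ℝ) (Λ : Finset Site) (n : ℕ) (f : Site → ℝ) : ℝ :=
  ∑ x : Λ, ∑ y : Λ, if IsAbove x y then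
    (occ (weight q) n y - occ₂ (weight q) n x y) * (f x - f y) ^ 2 else 0

lemma sum_hole_particle {q : ℝ} (hq : 0 < q) {n : ℕ} (hn : n ≤ Fintype.card Λ) (x y : Λ) :
    ∑ σ : Config Λ, (if σ x = 0 ∧ σ y = 1 then ‖groundVector q n σ‖ ^ 2 else 0) =
      esym (weight q : Λ → ℝ) Finset.univ n * (occ (weight q) n y - occ₂ (weight q) n x y) := by
  have h : occ (weight q) n y - occ₂ (weight q) n x y = canonMean (weight q) n fun T =>
      (if y ∈ T then 1 else 0) + (-1) * (if x ∈ T ∧ y ∈ T then 1 else 0) := by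
    rw [canonMean_add, canonMean_smul, occ, occ₂]
    ring
  rw [h, ← sum_norm_sq_groundVector hq hn]
  refine Finset.sum_congr rfl fun σ _ => ?_
  simp only [mem_downSet]
  rcases Fin.exists_fin_two.1 ⟨σ x, rfl⟩ with hx | hx <;>
    rcases Fin.exists_fin_two.1 ⟨σ y, rfl⟩ with hy | hy <;> simp [hx, hy]

lemma bondEnergy_diagonalObservable {q : ℝ} (hq : 0 < q) {n : ℕ} (hn : n ≤ Fintype.card Λ) (c : ℂ)
    (f : Site → ℝ) (a : ℝ) :
    bondEnergy q (diagonalObservable (fun T : Finset Λ => ∑ x ∈ T, f x - a) *ᵥ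
      (c • groundVector q n)) =
      ‖c‖ ^ 2 * esym (weight q : Λ → ℝ) Finset.univ n * dirichletForm q Λ n f := by
  rw [bondEnergy, dirichletForm, Finset.mul_sum]
  refine Finset.sum_congr rfl fun x _ => ?_
  rw [Finset.mul_sum]
  refine Finset.sum_congr rfl fun y _ => ?_
  split_ifs with h
  · have h1 : ‖c‖ ^ 2 * esym (weight q : Λ → ℝ) Finset.univ n *
        ((occ (weight q) n y - occ₂ (weight q) n x y) * (f x - f y) ^ 2) =
        ‖c‖ ^ 2 * (f x - f y) ^ 2 * (esym (weight q : Λ → ℝ) Finset.univ n *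
        (occ (weight q) n y - occ₂ (weight q) n x y)) := by ring
    rw [h1, ← sum_hole_particle hq hn, bondSquare, Finset.mul_sum]
    refine Finset.sum_congr rfl fun σ _ => ?_
    split_ifs with hσ
    · have h2 := sum_downSet_exchange hσ.1 hσ.2 (fun x : Λ => f x)
      have h3 : (q : ℂ) * (c * groundVector q n (exchange x y σ)) = c * groundVector q n σ := by
        rw [groundVector_exchange hq n h hσ.1 hσ.2]
        ring
      rw [diagonalObservable_mulVec, diagonalObservable_mulVec, Pi.smul_apply, Pi.smul_apply,
        smul_eq_mul, smul_eq_mul, mul_left_comm (q : ℂ), h3, ← sub_mul, ← Complex.ofReal_sub,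
        norm_mul, norm_mul, Complex.norm_real, Real.norm_eq_abs, mul_pow, mul_pow, sq_abs,
        sub_sub_sub_cancel_right, h2]
      ring
    · simp
  · simp

/-- Multiplying a ground state by a centred linear statistic of the occupation numbers. -/
lemma mem_excitationEnergies {q : ℝ} (hq : q ∈ Set.Ioo (0 : ℝ) 1) {n : ℕ}
    (hn : n ≤ Fintype.card Λ) {c : ℂ} (hc : c ≠ 0) {f : Site → ℝ} {S : Set Site}
    (hf : ∀ x ∉ S, f x = 0)
    (hvar : 0 < canonMean (weight q : Λ → ℝ) n
      (fun T => (∑ x ∈ T, f x - ∑ x : Λ, f x * occ (weight q) n x) ^ 2)) :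
    2 / (1 + q ^ 2) * (dirichletForm q Λ n f / canonMean (weight q : Λ → ℝ) n
      (fun T => (∑ x ∈ T, f x - ∑ x : Λ, f x * occ (weight q) n x) ^ 2)) ∈
      excitationEnergies ((q + q⁻¹) / 2) (c • groundVector q n : State Λ) S := by
  set a := ∑ x : Λ, f x * occ (weight q) n x with ha
  set F : Finset Λ → ℝ := fun T => ∑ x ∈ T, f x - a with hF
  set v := canonMean (weight q : Λ → ℝ) n (fun T => (∑ x ∈ T, f x - a) ^ 2) with hv
  set ψ : State Λ := c • groundVector q n with hψ
  have hZ : 0 < esym (weight q : Λ → ℝ) Finset.univ n :=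
    esym_pos (weight_pos hq.1) (by simpa using hn)
  have hc' : 0 < ‖c‖ ^ 2 := by positivity
  have hψσ : ∀ σ, ‖ψ σ‖ ^ 2 = ‖c‖ ^ 2 * ‖groundVector q n σ‖ ^ 2 := fun σ => by
    rw [hψ, Pi.smul_apply, smul_eq_mul, norm_mul, mul_pow]
  have hnorm : ∑ σ, ‖(diagonalObservable F *ᵥ ψ) σ‖ ^ 2 =
      ‖c‖ ^ 2 * esym (weight q : Λ → ℝ) Finset.univ n * v := by
    rw [mul_assoc, hv, ← sum_norm_sq_groundVector hq.1 hn, Finset.mul_sum]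
    refine Finset.sum_congr rfl fun σ _ => ?_
    rw [diagonalObservable_mulVec, norm_mul, mul_pow, hψσ, Complex.norm_real, Real.norm_eq_abs,
      sq_abs, hF]
    ring
  have hne : diagonalObservable F *ᵥ ψ ≠ 0 := by
    intro h
    rw [h] at hnorm
    simp only [Pi.zero_apply, norm_zero, zero_pow two_ne_zero, Finset.sum_const_zero] at hnorm
    exact absurd hnorm.symm (by positivity)
  have hψne : ψ ≠ 0 := smul_ne_zero hc (groundVector_ne_zero hq.1 hn)
  have hmean : canonMean (weight q : Λ → ℝ) n F = 0 := by
    have : F = fun T : Finset Λ => ∑ x ∈ T, f x + (-a) := by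
      funext T
      rw [hF]
      ring
    rw [this, canonMean_add, canonMean_linear, canonMean_const (weight_pos hq.1) hn, ha]
    ring
  refine ⟨diagonalObservable F, isLocalizedIn_diagonalObservable hf a,
    commute_diagonalObservable_totalS3 F, hne, ?_, ?_⟩
  · have h : star ψ ⬝ᵥ (diagonalObservable F *ᵥ ψ) =
        ((∑ σ : Config Λ, ‖c‖ ^ 2 * (‖groundVector q n σ‖ ^ 2 * F (downSet σ)) : ℝ) : ℂ) := by
      rw [dotProduct]
      push_cast
      refine Finset.sum_congr rfl fun σ _ => ?_
      have h2 : star (ψ σ) * ψ σ = ((‖c‖ ^ 2 * ‖groundVector q n σ‖ ^ 2 : ℝ) : ℂ) := by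
        rw [← hψσ, Complex.star_def, ← Complex.normSq_eq_conj_mul_self, Complex.normSq_eq_norm_sq]
      push_cast at h2
      rw [diagonalObservable_mulVec, Pi.star_apply, ← mul_assoc, mul_right_comm, h2, mul_assoc]
    rw [h, ← Finset.mul_sum, sum_norm_sq_groundVector hq.1 hn, hmean, mul_zero, mul_zero,
      Complex.ofReal_zero]
  · rw [energy_eq hq hne, energy_eq hq hψne, hnorm]
    have h0 : bondEnergy q ψ = 0 := by
      have h1 := bondEnergy_diagonalObservable (Λ := Λ) hq.1 hn c (fun _ => 0) (-1)
      have h2 : dirichletForm q Λ n (fun _ => 0) = 0 := by simp [dirichletForm]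
      rw [h2, mul_zero] at h1
      rw [← h1]
      congr 1
      funext σ
      rw [diagonalObservable_mulVec]
      simp [hψ]
    rw [h0, bondEnergy_diagonalObservable hq.1 hn, zero_div, mul_zero, add_zero,
      mul_div_mul_left _ _ (by positivity)]
    ring

lemma bddBelow_excitationEnergies {q : ℝ} (hq : q ∈ Set.Ioo (0 : ℝ) 1) (ψ : State Λ)
    (S : Set Site) : BddBelow (excitationEnergies ((q + q⁻¹) / 2) ψ S) := by
  refine ⟨-(1 / 2) * bondCount Λ - energy (interfaceHamiltonian ((q + q⁻¹) / 2) Λ) ψ, ?_⟩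
  rintro e ⟨X, -, -, hne, -, rfl⟩
  rw [energy_eq hq hne]
  have h1 := div_nonneg (bondEnergy_nonneg q (X *ᵥ ψ)) (norm_sq_pos hne).le
  have h2 : 0 ≤ 2 / (1 + q ^ 2) := by positivity
  linarith [mul_nonneg h2 h1]

end Excitation

/-! ### Hexagonal tents in the 111 planes -/

section Tent

/-- The norm on the triangular lattice `{v ∈ ℤ³ | v₁ + v₂ + v₃ = 0}`, in the coordinates
`v = (i, j, -i - j)`, whose balls are hexagons. -/
def hexNorm (i j : ℤ) : ℕ := max i.natAbs (max j.natAbs (i + j).natAbs)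

lemma hexNorm_le {i j : ℤ} {n : ℕ} :
    hexNorm i j ≤ n ↔ i.natAbs ≤ n ∧ j.natAbs ≤ n ∧ (i + j).natAbs ≤ n := by
  simp [hexNorm]

/-- The box of coordinates that contains the hexagons of radius at most `M`. -/
def hexBox (M : ℕ) : Finset (ℤ × ℤ) := Finset.Icc (-(M : ℤ)) M ×ˢ Finset.Icc (-(M : ℤ)) M

lemma mem_hexBox {M : ℕ} {p : ℤ × ℤ} : p ∈ hexBox M ↔ p.1.natAbs ≤ M ∧ p.2.natAbs ≤ M := by
  simp only [hexBox, Finset.mem_product, Finset.mem_Icc]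
  omega

lemma card_hexBox (M : ℕ) : (hexBox M).card = (2 * M + 1) ^ 2 := by
  rw [hexBox, Finset.card_product, Int.card_Icc, sq]
  congr 1 <;> omega

/-- A hexagon without its centre consists of three rhombi, which a rotation permutes. -/
lemma le_card_hexagon {M N : ℕ} (h : N ≤ M) :
    3 * N ^ 2 + 3 * N + 1 ≤ ((hexBox M).filter fun p => hexNorm p.1 p.2 ≤ N).card := by
  set B : Finset (ℤ × ℤ) := Finset.Icc (1 : ℤ) N ×ˢ Finset.Icc (-(N : ℤ)) 0 with hB
  have hBc : B.card = N * (N + 1) := by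
    rw [hB, Finset.card_product, Int.card_Icc, Int.card_Icc]
    congr 1 <;> omega
  have memB : ∀ p : ℤ × ℤ, p ∈ B ↔ (1 ≤ p.1 ∧ p.1 ≤ N) ∧ (-(N : ℤ) ≤ p.2 ∧ p.2 ≤ 0) := by
    intro p
    simp only [hB, Finset.mem_product, Finset.mem_Icc]
  set r₁ : ℤ × ℤ → ℤ × ℤ := fun p => (-p.1 - p.2, p.1)
  set r₂ : ℤ × ℤ → ℤ × ℤ := fun p => (p.2, -p.1 - p.2)
  have inj₁ : Function.Injective r₁ := by
    rintro ⟨a, b⟩ ⟨c, d⟩ h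
    simp only [r₁, Prod.mk.injEq] at h ⊢
    omega
  have inj₂ : Function.Injective r₂ := by
    rintro ⟨a, b⟩ ⟨c, d⟩ h
    simp only [r₂, Prod.mk.injEq] at h ⊢
    omega
  have d₁ : Disjoint B (B.image r₁) := by
    rw [Finset.disjoint_left]
    rintro ⟨a, b⟩ h1 h2
    obtain ⟨⟨c, d⟩, h3, h4⟩ := Finset.mem_image.1 h2
    simp only [r₁, memB, Prod.mk.injEq] at h1 h3 h4
    omega
  have d₂ : Disjoint (B ∪ B.image r₁) (B.image r₂) := by
    rw [Finset.disjoint_left]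
    rintro ⟨a, b⟩ h1 h2
    obtain ⟨⟨c, d⟩, h3, h4⟩ := Finset.mem_image.1 h2
    simp only [r₂, memB, Prod.mk.injEq] at h3 h4
    rcases Finset.mem_union.1 h1 with h1 | h1
    · simp only [memB] at h1
      omega
    · obtain ⟨⟨e, f⟩, h5, h6⟩ := Finset.mem_image.1 h1
      simp only [r₁, memB, Prod.mk.injEq] at h5 h6
      omega
  have d₃ : ((0 : ℤ), (0 : ℤ)) ∉ (B ∪ B.image r₁) ∪ B.image r₂ := by
    intro h1
    simp only [Finset.mem_union, Finset.mem_image, memB, r₁, r₂, Prod.mk.injEq, Prod.exists] at h1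
    rcases h1 with (h1 | ⟨c, d, h1⟩) | ⟨c, d, h1⟩ <;> omega
  have hcard : (insert ((0 : ℤ), (0 : ℤ)) ((B ∪ B.image r₁) ∪ B.image r₂)).card =
      3 * N ^ 2 + 3 * N + 1 := by
    rw [Finset.card_insert_of_notMem d₃, Finset.card_union_of_disjoint d₂,
      Finset.card_union_of_disjoint d₁, Finset.card_image_of_injective _ inj₁,
      Finset.card_image_of_injective _ inj₂, hBc]
    ring
  rw [← hcard]
  refine Finset.card_le_card fun p hp => ?_
  rw [Finset.mem_filter, mem_hexBox, hexNorm_le]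
  simp only [Finset.mem_insert, Finset.mem_union, Finset.mem_image, memB, r₁, r₂, Prod.exists] at hp
  obtain ⟨a, b⟩ := p
  simp only [Prod.mk.injEq] at hp ⊢
  rcases hp with h1 | (h1 | ⟨c, d, h1⟩) | ⟨c, d, h1⟩ <;> omega

/-- The sum of the squares of the heights of a hexagonal tent; the subtraction is truncated. Raising
the tent by one adds one on a hexagon, so induction reduces the sums of the first and second powers
to the number of points of a hexagon. -/
lemma le_sum_tent_sq {M N : ℕ} (h : N ≤ M) :
    N ^ 4 ≤ 2 * ∑ p ∈ hexBox M, (N - hexNorm p.1 p.2) ^ 2 := by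
  suffices N ^ 3 ≤ ∑ p ∈ hexBox M, (N - hexNorm p.1 p.2) ∧
      N ^ 4 + N ^ 2 ≤ 2 * ∑ p ∈ hexBox M, (N - hexNorm p.1 p.2) ^ 2 from
    le_trans (Nat.le_add_right _ _) this.2
  induction N with
  | zero => simp
  | succ N ih =>
    obtain ⟨ih1, ih2⟩ := ih (by omega)
    have hc := le_card_hexagon (M := M) (N := N) (by omega)
    rw [Finset.card_filter] at hc
    have h1 : ∑ p ∈ hexBox M, (N + 1 - hexNorm p.1 p.2) = ∑ p ∈ hexBox M, (N - hexNorm p.1 p.2) +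
        ∑ p ∈ hexBox M, if hexNorm p.1 p.2 ≤ N then 1 else 0 := by
      rw [← Finset.sum_add_distrib]
      refine Finset.sum_congr rfl fun p _ => ?_
      split_ifs <;> omega
    have h2 : ∑ p ∈ hexBox M, (N + 1 - hexNorm p.1 p.2) ^ 2 =
        ∑ p ∈ hexBox M, (N - hexNorm p.1 p.2) ^ 2 + 2 * ∑ p ∈ hexBox M, (N - hexNorm p.1 p.2) +
        ∑ p ∈ hexBox M, if hexNorm p.1 p.2 ≤ N then 1 else 0 := by
      rw [Finset.mul_sum, ← Finset.sum_add_distrib, ← Finset.sum_add_distrib]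
      refine Finset.sum_congr rfl fun p _ => ?_
      split_ifs with h
      · rw [show N + 1 - hexNorm p.1 p.2 = (N - hexNorm p.1 p.2) + 1 by omega]
        ring
      · rw [show N + 1 - hexNorm p.1 p.2 = 0 by omega, show N - hexNorm p.1 p.2 = 0 by omega]
        rfl
    constructor
    · rw [h1]
      nlinarith
    · rw [h2]
      nlinarith

/-- The first coordinate, in the plane of height `l`, of a lattice path that stays close to the line
through `K` in the 111 direction. The third coordinate is `K 2 + (l - level K + 2) / 3`, so the
coordinates increase in turn. -/
def axis₀ (K : Site) (l : ℤ) : ℤ := K 0 + (l - level K) / 3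

/-- The second coordinate of the path described at `axis₀`. -/
def axis₁ (K : Site) (l : ℤ) : ℤ := K 1 + (l - level K + 1) / 3

/-- The distance of a site from the axis through `K`, in the hexagonal norm of its 111 plane. -/
def axisDist (K x : Site) : ℕ := hexNorm (x 0 - axis₀ K (level x)) (x 1 - axis₁ K (level x))

/-- A tent of height and radius `N` over a hexagon in each of the planes of heights `-h, …, h`. The
subtraction is truncated. -/
def tent (N h : ℕ) (K x : Site) : ℝ := if |level x| ≤ h then ((N - axisDist K x : ℕ) : ℝ) else 0

lemma tent_nonneg (N h : ℕ) (K x : Site) : 0 ≤ tent N h K x := by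
  unfold tent; positivity

lemma tent_le (N h : ℕ) (K x : Site) : tent N h K x ≤ N := by
  unfold tent
  split_ifs
  · exact_mod_cast Nat.sub_le _ _
  · positivity

lemma tent_ne_zero {N h : ℕ} {K x : Site} (hx : tent N h K x ≠ 0) :
    |level x| ≤ h ∧ axisDist K x < N := by
  unfold tent at hx
  split_ifs at hx with h1
  · refine ⟨h1, ?_⟩
    by_contra h2
    exact hx (by rw [Nat.sub_eq_zero_of_le (by omega), Nat.cast_zero])
  · exact absurd rfl hx

/-- A displacement within the hexagon of radius `r` has Euclidean norm at most `√2 r`; here it is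
perturbed in each coordinate. -/
lemma sum_sq_add_le {a b r u₀ u₁ u₂ : ℝ} (ha : -r ≤ a ∧ a ≤ r) (hb : -r ≤ b ∧ b ≤ r)
    (hab : -r ≤ a + b ∧ a + b ≤ r) (h₀ : |u₀| ≤ 7 / 6) (h₁ : |u₁| ≤ 7 / 6) (h₂ : |u₂| ≤ 7 / 6) :
    (a + u₀) ^ 2 + (b + u₁) ^ 2 + (-(a + b) + u₂) ^ 2 ≤
      2 * r ^ 2 + 14 / 3 * r + 3 * (7 / 6) ^ 2 := by
  -- The three coordinates add up to zero, so the largest is the sum of the other two.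
  have hsum : |a| + |b| + |a + b| ≤ 2 * r := by
    rcases abs_cases a with e | e <;> rcases abs_cases b with e' | e' <;>
      rcases abs_cases (a + b) with e'' | e'' <;> linarith
  have hsq : a ^ 2 + b ^ 2 + (a + b) ^ 2 ≤ 2 * r ^ 2 := by
    rcases le_total 0 a with ha | ha <;> rcases le_total 0 b with hb | hb <;>
      rcases le_total 0 (a + b) with hab | hab <;> nlinarith
  have hcross : ∀ s u : ℝ, |u| ≤ 7 / 6 → s * u ≤ 7 / 6 * |s| := by
    intro s u hu
    have h1 := le_abs_self (s * u)
    rw [abs_mul] at h1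
    have h2 := mul_le_mul_of_nonneg_left hu (abs_nonneg s)
    linarith
  have hsq' : ∀ u : ℝ, |u| ≤ 7 / 6 → u ^ 2 ≤ (7 / 6) ^ 2 := fun u hu =>
    sq_le_sq' (by linarith [(abs_le.1 hu).1]) (abs_le.1 hu).2
  have c₀ := hcross a u₀ h₀
  have c₁ := hcross b u₁ h₁
  have c₂ := hcross (-(a + b)) u₂ h₂
  rw [abs_neg] at c₂
  nlinarith [hsq' u₀ h₀, hsq' u₁ h₁, hsq' u₂ h₂]

/-- The axis starts at the lattice point nearest to `c`, so it stays within `1 / 2 + 2 / 3` of the axis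
of the cylinder in each coordinate. The hexagon of radius `0.68 R` lies in the disc of radius
`√2 · 0.68 R`, which leaves room for this displacement if `R > 70`. -/
lemma tent_mem_cylinder {c : EuclideanSpace ℝ (Fin 3)} {R : ℝ} (hR : 70 < R) {N h : ℕ}
    (hN : (N : ℝ) ≤ 0.68 * R + 1) {x : Site} (hx : tent N h (fun i => round (c i)) x ≠ 0) :
    x ∈ cylinder c R h := by
  obtain ⟨h1, h2⟩ := tent_ne_zero hx
  refine ⟨?_, h1⟩
  set K : Site := fun i => round (c i) with hK
  set l : ℤ := level x - level K with hl
  refine ⟨(l : ℝ) / 3, ?_⟩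
  have h3 : axisDist K x ≤ N - 1 := by omega
  rw [axisDist, hexNorm_le] at h3
  obtain ⟨v0, hv0⟩ : ∃ v, v = x 0 - axis₀ K (level x) := ⟨_, rfl⟩
  obtain ⟨v1, hv1⟩ : ∃ v, v = x 1 - axis₁ K (level x) := ⟨_, rfl⟩
  rw [← hv0, ← hv1] at h3
  obtain ⟨d0, hd0⟩ : ∃ d, d = l / 3 := ⟨_, rfl⟩
  obtain ⟨d1, hd1⟩ : ∃ d, d = (l + 1) / 3 := ⟨_, rfl⟩
  obtain ⟨d2, hd2⟩ : ∃ d, d = (l + 2) / 3 := ⟨_, rfl⟩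
  rw [axis₀, ← hl, ← hd0] at hv0
  rw [axis₁, ← hl, ← hd1] at hv1
  have hx2 : x 2 = -(v0 + v1) + K 2 + d2 := by
    have e1 : level x = x 0 + x 1 + x 2 := by rw [level, Fin.sum_univ_three]
    have e2 : level K = K 0 + K 1 + K 2 := by rw [level, Fin.sum_univ_three]
    omega
  have hx0 : x 0 = v0 + K 0 + d0 := by omega
  have hx1 : x 1 = v1 + K 1 + d1 := by omega
  have hd : ∀ d : ℤ, (3 * d - l ≤ 2 ∧ -2 ≤ 3 * d - l) → |(d : ℝ) - l / 3| ≤ 2 / 3 := by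
    intro d hd
    have e1 : (3 * d - l : ℝ) ≤ 2 := by exact_mod_cast hd.1
    have e2 : (-2 : ℝ) ≤ 3 * d - l := by exact_mod_cast hd.2
    rw [abs_le]
    constructor <;> linarith
  have ho : ∀ (i : Fin 3) (d : ℤ), (3 * d - l ≤ 2 ∧ -2 ≤ 3 * d - l) →
      |(K i : ℝ) - c i + (d - l / 3)| ≤ 7 / 6 := by
    intro i d hd'
    have e1 := abs_sub_round (c i)
    rw [abs_sub_comm] at e1
    calc _ ≤ |(K i : ℝ) - c i| + |(d : ℝ) - l / 3| := abs_add_le _ _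
      _ ≤ 1 / 2 + 2 / 3 := add_le_add e1 (hd d hd')
      _ = 7 / 6 := by norm_num
  have o0 := ho 0 d0 (by omega)
  have o1 := ho 1 d1 (by omega)
  have o2 := ho 2 d2 (by omega)
  set u0 : ℝ := (K 0 : ℝ) - c 0 + (d0 - l / 3)
  set u1 : ℝ := (K 1 : ℝ) - c 1 + (d1 - l / 3)
  set u2 : ℝ := (K 2 : ℝ) - c 2 + (d2 - l / 3)
  have hdist : dist (WithLp.toLp 2 fun i => (x i : ℝ)) (c + ((l : ℝ) / 3) • !₂[(1 : ℝ), 1, 1]) =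
      Real.sqrt ((v0 + u0) ^ 2 + (v1 + u1) ^ 2 + (-(v0 + v1) + u2) ^ 2) := by
    rw [EuclideanSpace.dist_eq, Fin.sum_univ_three]
    simp only [Real.dist_eq, sq_abs]
    congr 2
    · congr 1
      · simp [hx0, u0]; ring
      · simp [hx1, u1]; ring
    · simp [hx2, u2]; ring
  rw [hdist]
  refine Real.sqrt_le_iff.2 ⟨by linarith, ?_⟩
  obtain ⟨r, hr⟩ : ∃ r : ℝ, r = 0.68 * R := ⟨_, rfl⟩
  have hr0 : 0 ≤ r := by linarith
  have hN1 : ((N - 1 : ℕ) : ℝ) ≤ r := by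
    rw [Nat.cast_sub (by omega)]
    push_cast
    linarith
  have habs : ∀ v : ℤ, v.natAbs ≤ N - 1 → |(v : ℝ)| ≤ r := by
    intro v hv
    have e1 : |v| ≤ ((N - 1 : ℕ) : ℤ) := abs_le.2 ⟨by omega, by omega⟩
    have e2 : |(v : ℝ)| ≤ ((N - 1 : ℕ) : ℝ) := by exact_mod_cast e1
    exact e2.trans hN1
  have a0 := abs_le.1 (habs v0 h3.1)
  have a1 := abs_le.1 (habs v1 h3.2.1)
  have a2 := abs_le.1 (habs (v0 + v1) h3.2.2)
  push_cast at a2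
  have := sum_sq_add_le (a := v0) (b := v1) a0 a1 a2 o0 o1 o2
  rw [hr] at this
  nlinarith

end Tent

section LayerSums

/-- The neighbour of `x` above it in the direction of the `i`-th axis. -/
def up (x : Site) (i : Fin 3) : Site := x + Pi.single i 1

lemma level_up (x : Site) (i : Fin 3) : level (up x i) = level x + 1 := by
  rw [level, level, up]
  simp [Finset.sum_add_distrib]

lemma up_injective (x : Site) : Function.Injective (up x) := by
  intro i j h
  have h1 := congrFun (add_left_cancel h) i
  by_contra hij
  simp [Pi.single_eq_of_ne hij] at h1

lemma IsAbove.exists_eq_up {x y : Site} (h : IsAbove x y) : ∃ i, y = up x i := by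
  obtain ⟨h1, h2⟩ := h
  simp only [Neighbour, level, Fin.sum_univ_three] at h1 h2
  have h3 : (y 0 = x 0 + 1 ∧ y 1 = x 1 ∧ y 2 = x 2) ∨ (y 0 = x 0 ∧ y 1 = x 1 + 1 ∧ y 2 = x 2) ∨
      (y 0 = x 0 ∧ y 1 = x 1 ∧ y 2 = x 2 + 1) := by
    rcases abs_cases (x 0 - y 0) with a | a <;> rcases abs_cases (x 1 - y 1) with b | b <;>
      rcases abs_cases (x 2 - y 2) with c | c <;> omega
  rcases h3 with h3 | h3 | h3
  · refine ⟨0, funext fun k => ?_⟩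
    fin_cases k <;> simp [up, h3]
  · refine ⟨1, funext fun k => ?_⟩
    fin_cases k <;> simp [up, h3]
  · refine ⟨2, funext fun k => ?_⟩
    fin_cases k <;> simp [up, h3]

lemma axisDist_up (K x : Site) (i : Fin 3) :
    axisDist K x ≤ axisDist K (up x i) + 1 ∧ axisDist K (up x i) ≤ axisDist K x + 1 := by
  simp only [axisDist, level_up, axis₀, axis₁, hexNorm]
  fin_cases i <;> simp [up] <;> omega

/-- One of the three steps upwards is the step of the axis, and the displacement from the axis does
not change. This makes the factor `2`, not `3`, in `slopeBound`. -/
lemma exists_axisDist_up_eq (K x : Site) : ∃ i, axisDist K (up x i) = axisDist K x := by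
  have h : (level x - level K) % 3 = 0 ∨ (level x - level K) % 3 = 1 ∨
      (level x - level K) % 3 = 2 := by omega
  rcases h with h | h | h
  · have h0 : axis₀ K (level x + 1) = axis₀ K (level x) := by simp only [axis₀]; omega
    have h1 : axis₁ K (level x + 1) = axis₁ K (level x) := by simp only [axis₁]; omega
    exact ⟨2, by rw [axisDist, axisDist, level_up, h0, h1]; simp [up]⟩
  · have h0 : axis₀ K (level x + 1) = axis₀ K (level x) := by simp only [axis₀]; omega
    have h1 : axis₁ K (level x + 1) = axis₁ K (level x) + 1 := by simp only [axis₁]; omega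
    exact ⟨1, by rw [axisDist, axisDist, level_up, h0, h1]; simp [up]⟩
  · have h0 : axis₀ K (level x + 1) = axis₀ K (level x) + 1 := by simp only [axis₀]; omega
    have h1 : axis₁ K (level x + 1) = axis₁ K (level x) := by simp only [axis₁]; omega
    exact ⟨0, by rw [axisDist, axisDist, level_up, h0, h1]; simp [up]⟩

/-- A bound for the squared differences of the tent on the bonds upwards from a site at height `l`:
the slope is one inside, while the tent breaks off at the planes of heights `±h`. -/
def slopeBound (N h : ℕ) (l : ℤ) : ℝ :=
  if -(h : ℤ) ≤ l ∧ l < h then 2 else if l = h ∨ l = -h - 1 then 3 * (N : ℝ) ^ 2 else 0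

lemma slopeBound_nonneg (N h : ℕ) (l : ℤ) : 0 ≤ slopeBound N h l := by
  unfold slopeBound; positivity

lemma sum_up_le (N h : ℕ) (K x : Site) :
    ∑ i, (tent N h K x - tent N h K (up x i)) ^ 2 ≤
      if axisDist K x ≤ N then slopeBound N h (level x) else 0 := by
  have hle : ∀ y, tent N h K y ^ 2 ≤ (N : ℝ) ^ 2 := fun y =>
    pow_le_pow_left₀ (tent_nonneg N h K y) (tent_le N h K y) 2
  by_cases hN : axisDist K x ≤ N
  · rw [if_pos hN, slopeBound]
    split_ifs with h1 h2
    · have hdiff : ∀ i, tent N h K x - tent N h K (up x i) =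
          ((N - axisDist K x : ℕ) : ℝ) - ((N - axisDist K (up x i) : ℕ) : ℝ) := by
        intro i
        rw [tent, tent, level_up, if_pos (abs_le.2 ⟨by omega, by omega⟩),
          if_pos (abs_le.2 ⟨by omega, by omega⟩)]
      have h1 : ∀ i, (tent N h K x - tent N h K (up x i)) ^ 2 ≤ 1 := by
        intro i
        obtain ⟨e1, e2⟩ := axisDist_up K x i
        have e3 : N - axisDist K x ≤ N - axisDist K (up x i) + 1 := by omega
        have e4 : N - axisDist K (up x i) ≤ N - axisDist K x + 1 := by omega
        have e5 : ((N - axisDist K x : ℕ) : ℝ) ≤ ((N - axisDist K (up x i) : ℕ) : ℝ) + 1 := by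
          exact_mod_cast e3
        have e6 : ((N - axisDist K (up x i) : ℕ) : ℝ) ≤ ((N - axisDist K x : ℕ) : ℝ) + 1 := by
          exact_mod_cast e4
        rw [hdiff, sq_le_one_iff_abs_le_one, abs_le]
        constructor <;> linarith
      obtain ⟨i, hi⟩ := exists_axisDist_up_eq K x
      have h0 : (tent N h K x - tent N h K (up x i)) ^ 2 = 0 := by
        rw [hdiff, hi, sub_self, zero_pow two_ne_zero]
      rw [← Finset.add_sum_erase _ _ (Finset.mem_univ i), h0, zero_add]
      refine (Finset.sum_le_sum fun j _ => h1 j).trans ?_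
      simp
    · have h3 : ∀ i, (tent N h K x - tent N h K (up x i)) ^ 2 ≤ (N : ℝ) ^ 2 := by
        intro i
        rcases h2 with h2 | h2
        · have h0 : tent N h K (up x i) = 0 := by
            rw [tent, level_up, if_neg]
            rw [abs_le]
            omega
          rw [h0, sub_zero]
          exact hle x
        · have h0 : tent N h K x = 0 := by
            rw [tent, if_neg]
            rw [abs_le]
            omega
          rw [h0, zero_sub, neg_sq]
          exact hle _
      refine (Finset.sum_le_sum fun i _ => h3 i).trans ?_
      simp
    · refine (Finset.sum_eq_zero fun i _ => ?_).le
      rw [tent, if_neg, tent, if_neg, sub_zero, zero_pow two_ne_zero]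
      · rw [level_up, abs_le]
        omega
      · rw [abs_le]
        omega
  · rw [if_neg hN]
    have h0 : ∀ y : Site, N ≤ axisDist K y → tent N h K y = 0 := by
      intro y hy
      by_contra h0
      have := (tent_ne_zero h0).2
      omega
    refine (Finset.sum_eq_zero fun i _ => ?_).le
    rw [h0 x (by omega), h0 _ (by have := (axisDist_up K x i).1; omega), sub_zero,
      zero_pow two_ne_zero]

lemma sum_isAbove_le {Λ : Finset Site} (N h : ℕ) (K : Site) (x : Λ) :
    ∑ y : Λ, (if IsAbove (x : Site) y then (tent N h K x - tent N h K y) ^ 2 else 0) ≤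
      if axisDist K x ≤ N then slopeBound N h (level x) else 0 := by
  refine le_trans ?_ (sum_up_le N h K x)
  rw [Finset.sum_coe_sort Λ (fun y => if IsAbove (x : Site) y then
    (tent N h K x - tent N h K y) ^ 2 else 0), ← Finset.sum_filter,
    ← Finset.sum_image (f := fun y => (tent N h K x - tent N h K y) ^ 2)
      (g := up (x : Site)) (fun i _ j _ hij => up_injective _ hij)]
  refine Finset.sum_le_sum_of_subset_of_nonneg ?_ fun _ _ _ => sq_nonneg _
  intro y hy
  obtain ⟨i, rfl⟩ := (Finset.mem_filter.1 hy).2.exists_eq_up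
  exact Finset.mem_image_of_mem _ (Finset.mem_univ i)

/-- The coordinates of a site relative to the axis through `K`: its height, and its displacement
from the axis. -/
def axisCoord (K x : Site) : ℤ × (ℤ × ℤ) :=
  (level x, (x 0 - axis₀ K (level x), x 1 - axis₁ K (level x)))

/-- The site with given coordinates relative to the axis through `K`. -/
def axisSite (K : Site) (p : ℤ × (ℤ × ℤ)) : Site :=
  ![p.2.1 + axis₀ K p.1, p.2.2 + axis₁ K p.1,
    p.1 - (p.2.1 + axis₀ K p.1) - (p.2.2 + axis₁ K p.1)]

lemma level_axisSite (K : Site) (p : ℤ × (ℤ × ℤ)) : level (axisSite K p) = p.1 := by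
  simp only [level, axisSite, Fin.sum_univ_three, Matrix.cons_val]
  ring

lemma axisCoord_axisSite (K : Site) (p : ℤ × (ℤ × ℤ)) : axisCoord K (axisSite K p) = p := by
  rw [axisCoord, level_axisSite]
  simp [axisSite]

lemma axisSite_axisCoord (K x : Site) : axisSite K (axisCoord K x) = x := by
  funext i
  have : level x = x 0 + x 1 + x 2 := by rw [level, Fin.sum_univ_three]
  fin_cases i <;> simp [axisSite, axisCoord]
  omega

lemma axisDist_axisSite (K : Site) (p : ℤ × (ℤ × ℤ)) :
    axisDist K (axisSite K p) = hexNorm p.2.1 p.2.2 := by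
  have h := congrArg Prod.snd (axisCoord_axisSite K p)
  simp only [axisCoord] at h
  rw [axisDist]
  rw [← h]

/-- A sum over the sites near the axis of a function of the height. -/
lemma sum_level_le (Λ : Finset Site) (N : ℕ) (K : Site) {g : ℤ → ℝ} (hg : ∀ l, 0 ≤ g l)
    {I : Finset ℤ} (hI : ∀ l ∉ I, g l = 0) :
    ∑ x : Λ, (if axisDist K x ≤ N then g (level x) else 0) ≤ (2 * N + 1) ^ 2 * ∑ l ∈ I, g l := by
  have h1 : ((2 * N + 1) ^ 2 : ℝ) * ∑ l ∈ I, g l = ∑ p ∈ I ×ˢ hexBox N, g p.1 := by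
    rw [Finset.sum_product, Finset.mul_sum]
    refine Finset.sum_congr rfl fun l _ => ?_
    simp only [Finset.sum_const, card_hexBox, nsmul_eq_mul]
    push_cast
    ring
  rw [h1, Finset.sum_coe_sort Λ (fun x => if axisDist K x ≤ N then g (level x) else 0),
    ← Finset.sum_filter, ← Finset.sum_filter_of_ne (p := fun x => level x ∈ I)
      (fun x _ hx => by by_contra h; exact hx (hI _ h))]
  have hinj : Set.InjOn (axisCoord K) ((Λ.filter fun x => axisDist K x ≤ N).filter
      fun x => level x ∈ I : Finset Site) := fun x _ y _ hxy => by
    rw [← axisSite_axisCoord K x, hxy, axisSite_axisCoord]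
  refine (Finset.sum_image (f := fun p : ℤ × (ℤ × ℤ) => g p.1) (g := axisCoord K) hinj).symm.le.trans
    ?_
  refine Finset.sum_le_sum_of_subset_of_nonneg ?_ fun _ _ _ => hg _
  intro p hp
  obtain ⟨x, hx, rfl⟩ := Finset.mem_image.1 hp
  obtain ⟨hx1, hx2⟩ := Finset.mem_filter.1 hx
  have hd := (Finset.mem_filter.1 hx1).2
  rw [axisDist, hexNorm_le] at hd
  exact Finset.mem_product.2 ⟨hx2, mem_hexBox.2 ⟨hd.1, hd.2.1⟩⟩

/-- In a volume that contains the support of the tent, each plane contributes at least `N ^ 4 / 2`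
to the sum of the squares. -/
lemma le_sum_tent_sq_mul {Λ : Finset Site} {N h : ℕ} {K : Site}
    (hΛ : ∀ x, tent N h K x ≠ 0 → x ∈ Λ) {g : ℤ → ℝ} (hg : ∀ l, 0 ≤ g l) :
    (N : ℝ) ^ 4 / 2 * ∑ l ∈ Finset.Icc (-(h : ℤ)) h, g l ≤
      ∑ x : Λ, tent N h K x ^ 2 * g (level x) := by
  have hsq : (N : ℝ) ^ 4 / 2 ≤ ∑ p ∈ hexBox N, ((N - hexNorm p.1 p.2 : ℕ) : ℝ) ^ 2 := by
    have := le_sum_tent_sq (le_refl N)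
    have h2 : (N : ℝ) ^ 4 ≤ 2 * ∑ p ∈ hexBox N, ((N - hexNorm p.1 p.2 : ℕ) : ℝ) ^ 2 := by
      exact_mod_cast this
    linarith
  have h1 : ∑ l ∈ Finset.Icc (-(h : ℤ)) h, g l * ∑ p ∈ hexBox N,
      ((N - hexNorm p.1 p.2 : ℕ) : ℝ) ^ 2 = ∑ p ∈ Finset.Icc (-(h : ℤ)) h ×ˢ hexBox N,
        tent N h K (axisSite K p) ^ 2 * g (level (axisSite K p)) := by
    rw [Finset.sum_product]
    refine Finset.sum_congr rfl fun l hl => ?_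
    rw [Finset.mul_sum]
    refine Finset.sum_congr rfl fun p _ => ?_
    rw [tent, level_axisSite, axisDist_axisSite, if_pos (abs_le.2 (Finset.mem_Icc.1 hl))]
    ring
  have hinj : Set.InjOn (axisSite K) ((Finset.Icc (-(h : ℤ)) h ×ˢ hexBox N).filter
      fun p => tent N h K (axisSite K p) ≠ 0 : Finset (ℤ × (ℤ × ℤ))) := fun p _ p' _ hp => by
    rw [← axisCoord_axisSite K p, hp, axisCoord_axisSite]
  calc _ ≤ ∑ l ∈ Finset.Icc (-(h : ℤ)) h, g l * ∑ p ∈ hexBox N,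
      ((N - hexNorm p.1 p.2 : ℕ) : ℝ) ^ 2 := by
        rw [Finset.mul_sum]
        refine Finset.sum_le_sum fun l _ => ?_
        rw [mul_comm]
        exact mul_le_mul_of_nonneg_left hsq (hg l)
    _ = ∑ p ∈ (Finset.Icc (-(h : ℤ)) h ×ˢ hexBox N).filter
        (fun p => tent N h K (axisSite K p) ≠ 0),
        tent N h K (axisSite K p) ^ 2 * g (level (axisSite K p)) := by
        rw [h1, Finset.sum_filter_of_ne]
        intro p _ hp h0
        rw [h0, zero_pow two_ne_zero, zero_mul] at hp
        exact hp rfl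
    _ ≤ ∑ x ∈ Λ, tent N h K x ^ 2 * g (level x) := by
        rw [← Finset.sum_image (f := fun x => tent N h K x ^ 2 * g (level x)) hinj]
        refine Finset.sum_le_sum_of_subset_of_nonneg ?_ fun _ _ _ => mul_nonneg (sq_nonneg _) (hg _)
        intro x hx
        obtain ⟨p, hp, rfl⟩ := Finset.mem_image.1 hx
        exact hΛ _ (Finset.mem_filter.1 hp).2
    _ = _ := (Finset.sum_coe_sort Λ (fun x => tent N h K x ^ 2 * g (level x))).symm

/-- The support of the tent is a finite set. -/
lemma finite_support_tent (N h : ℕ) (K : Site) : {x | tent N h K x ≠ 0}.Finite := by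
  refine ((Finset.Icc (-(h : ℤ)) h ×ˢ hexBox N).image (axisSite K)).finite_toSet.subset ?_
  intro x hx
  obtain ⟨h1, h2⟩ := tent_ne_zero hx
  have h3 : axisDist K x ≤ N := h2.le
  rw [axisDist, hexNorm_le] at h3
  rw [Finset.mem_coe, Finset.mem_image]
  refine ⟨axisCoord K x, Finset.mem_product.2 ⟨?_, mem_hexBox.2 ⟨h3.1, h3.2.1⟩⟩,
    axisSite_axisCoord K x⟩
  exact Finset.mem_Icc.2 (abs_le.1 h1)

end LayerSums

/-! ### The occupation of the 111 planes -/

/-- Distinct powers of `q` add up to at most the geometric series. -/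
lemma sum_pow_le {q : ℝ} (hq : q ∈ Set.Ioo (0 : ℝ) 1) {s : Finset ℤ} {φ : ℤ → ℕ}
    (hφ : Set.InjOn φ s) : ∑ l ∈ s, q ^ φ l ≤ (1 - q)⁻¹ := by
  rw [← Finset.sum_image (f := fun d => q ^ d) hφ, ← tsum_geometric_of_lt_one hq.1.le hq.2]
  exact (summable_geometric_of_lt_one hq.1.le hq.2).sum_le_tsum _
    fun d _ => pow_nonneg hq.1.le d

/-- If the planes up to height `m` are filled up to an excess of less than one plane, then one of
the planes `m` and `m + 1` is neither almost empty nor almost full. The tail estimate `htail`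
makes the contributions of the other planes to the excess small when the plane `m + 1` is almost
full or the plane `m` almost empty; `hex` excludes that `m` is almost full and `m + 1` almost
empty. -/
lemma exists_partially_filled {q ν η : ℝ} (hq : q ∈ Set.Ioo (0 : ℝ) 1) (hν : ν ∈ Set.Ico (0 : ℝ) 1)
    (hη : 0 < η) (hηq : η ≤ q) (hην : η * (1 - q)⁻¹ + η ≤ (1 - ν) / 4) {P : ℤ → ℝ}
    (hP : ∀ l, 0 ≤ P l ∧ P l ≤ 1) {a b m : ℤ} (ham : a < m) (hmb : m + 1 ≤ b)
    (hanti : ∀ l l', a < l → l < l' → l' ≤ b → P l' ≤ P l)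
    (htail : ∀ l l', a < l → l < l' → l' ≤ b → P l' * (1 - P l) ≤ q ^ (2 * (l' - l).toNat))
    (hex : q ^ 2 * (P m * (1 - P (m + 1))) - q ^ 2 / 16 ≤ (1 - P m) * P (m + 1))
    (hsum : ∑ l ∈ Finset.Ioc a b, P l + a - m ∈ Set.Icc (-(1 / 2)) ((1 + ν) / 2)) :
    η ^ 2 / 8 ≤ P m * (1 - P m) ∨ η ^ 2 / 8 ≤ P (m + 1) * (1 - P (m + 1)) := by
  obtain ⟨hq0, hq1⟩ := hq
  have hν0 := hν.1
  have hν1 := hν.2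
  have hgeo : 0 < (1 - q)⁻¹ := inv_pos.2 (by linarith)
  have hη4 : η ≤ 1 / 4 := by nlinarith [mul_pos hη hgeo]
  set ε := η ^ 2 / 4 with hε
  have hε0 : 0 < ε := by positivity
  have hεη : ε ≤ η / 16 := by nlinarith
  have hsplit : ∑ l ∈ Finset.Ioc a b, P l + a - m =
      ∑ l ∈ Finset.Ioc m b, P l - ∑ l ∈ Finset.Ioc a m, (1 - P l) := by
    rw [← Finset.Ioc_union_Ioc_eq_Ioc ham.le (by omega : m ≤ b),
      Finset.sum_union (Finset.Ioc_disjoint_Ioc_of_le le_rfl), Finset.sum_sub_distrib,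
      Finset.sum_const, Int.card_Ioc, nsmul_eq_mul]
    have : (((m - a).toNat : ℕ) : ℝ) = m - a := by
      have h : (((m - a).toNat : ℕ) : ℤ) = m - a := Int.toNat_of_nonneg (by omega)
      exact_mod_cast h
    rw [this]
    ring
  rw [hsplit] at hsum
  -- An occupation below `ε` and below `2 q ^ (2 d)` is below the geometric mean of the two bounds.
  have hgm : ∀ (t : ℝ) (d : ℕ), 0 ≤ t → t ≤ ε → t * (1 - ε) ≤ q ^ (2 * d) → t ≤ η * q ^ d := by
    intro t d ht0 ht1 ht2
    refine abs_le_of_sq_le_sq' ?_ (by positivity) |>.2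
    have h1 : t ≤ 2 * q ^ (2 * d) := by nlinarith
    have h2 : t * t ≤ ε * (2 * q ^ (2 * d)) := mul_le_mul ht1 h1 ht0 hε0.le
    have h3 : 0 ≤ η ^ 2 * q ^ (2 * d) := by positivity
    rw [mul_pow, ← pow_mul, mul_comm d 2, sq t]
    nlinarith
  by_cases h1 : 1 - ε ≤ P (m + 1)
  · exfalso
    have hb : ∀ l ∈ Finset.Ioc a m, 1 - P l ≤ η * q ^ (m + 1 - l).toNat := by
      intro l hl
      have hl' := Finset.mem_Ioc.1 hl
      have e1 := hanti l (m + 1) hl'.1 (by omega) hmb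
      have e2 := htail l (m + 1) hl'.1 (by omega) hmb
      refine hgm _ _ (by linarith [(hP l).2]) (by linarith) ?_
      nlinarith [(hP l).2]
    have hs := Finset.sum_le_sum hb
    rw [← Finset.mul_sum] at hs
    have hs2 := sum_pow_le ⟨hq0, hq1⟩ (s := Finset.Ioc a m) (φ := fun l => (m + 1 - l).toNat) (by
      intro l hl l' hl' h
      simp only [Finset.coe_Ioc, Set.mem_Ioc] at hl hl' h
      omega)
    have hs3 := mul_le_mul_of_nonneg_left hs2 hη.le
    have hs4 : P (m + 1) ≤ ∑ l ∈ Finset.Ioc m b, P l :=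
      Finset.single_le_sum (fun l _ => (hP l).1) (Finset.mem_Ioc.2 ⟨by omega, hmb⟩)
    linarith [hsum.2]
  by_cases h2 : P m ≤ ε
  · exfalso
    have hb : ∀ l ∈ Finset.Ioc m b, P l ≤ η * q ^ (l - m).toNat := by
      intro l hl
      have hl' := Finset.mem_Ioc.1 hl
      have e1 := hanti m l ham hl'.1 hl'.2
      have e2 := htail m l ham hl'.1 hl'.2
      refine hgm _ _ (hP l).1 (by linarith) ?_
      nlinarith [(hP l).1]
    have hs := Finset.sum_le_sum hb
    rw [← Finset.mul_sum] at hs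
    have hs2 := sum_pow_le ⟨hq0, hq1⟩ (s := Finset.Ioc m b) (φ := fun l => (l - m).toNat) (by
      intro l hl l' hl' h
      simp only [Finset.coe_Ioc, Set.mem_Ioc] at hl hl' h
      omega)
    have hs3 := mul_le_mul_of_nonneg_left hs2 hη.le
    have hs4 : 1 - P m ≤ ∑ l ∈ Finset.Ioc a m, (1 - P l) :=
      Finset.single_le_sum (f := fun l => 1 - P l) (fun l _ => by linarith [(hP l).2])
        (Finset.mem_Ioc.2 ⟨ham, le_rfl⟩)
    linarith [hsum.1]
  push Not at h1 h2
  by_cases h3 : P m ≤ 1 - ε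
  · left
    nlinarith
  by_cases h4 : ε ≤ P (m + 1)
  · right
    nlinarith
  exfalso
  push Not at h3 h4
  have e1 : (1 - P m) * P (m + 1) ≤ ε * ε :=
    mul_le_mul (by linarith) h4.le (hP _).1 hε0.le
  have e2 : (3 / 4) * (3 / 4) ≤ P m * (1 - P (m + 1)) :=
    mul_le_mul (by linarith) (by linarith) (by norm_num) (hP m).1
  have e3 : ε * ε ≤ (q / 16) * (q / 16) := mul_le_mul (by linarith) (by linarith) hε0.le (by linarith)
  nlinarith [mul_le_mul_of_nonneg_left e2 (sq_nonneg q), mul_pos hq0 hq0]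

section Planes

variable {Λ : Finset Site}

/-- The probability that a site of `Λ` at height `l` carries a down spin; the choice of the site
does not matter. It is zero if there is no such site. -/
def planeOcc (q : ℝ) (Λ : Finset Site) (n : ℕ) (l : ℤ) : ℝ :=
  open scoped Classical in
  if h : ∃ x : Λ, level (x : Site) = l then occ (weight q) n h.choose else 0

/-- The variance of the occupation number of a site at height `l`. -/
def planeVar (q : ℝ) (Λ : Finset Site) (n : ℕ) (l : ℤ) : ℝ :=
  planeOcc q Λ n l * (1 - planeOcc q Λ n l)

lemma planeOcc_mem {q : ℝ} (hq : 0 < q) (n : ℕ) (l : ℤ) :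
    0 ≤ planeOcc q Λ n l ∧ planeOcc q Λ n l ≤ 1 := by
  unfold planeOcc
  split_ifs
  · exact ⟨occ_nonneg (weight_pos hq) _ _, occ_le_one (weight_pos hq) _ _⟩
  · simp

lemma planeVar_nonneg {q : ℝ} (hq : 0 < q) (n : ℕ) (l : ℤ) : 0 ≤ planeVar q Λ n l :=
  mul_nonneg (planeOcc_mem hq n l).1 (sub_nonneg.2 (planeOcc_mem hq n l).2)

lemma planeOcc_level {q : ℝ} (hq : 0 < q) (j : ℕ) (x : Λ) :
    planeOcc q Λ (j + 2) (level x) = occ (weight q) (j + 2) x := by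
  have h : ∃ y : Λ, level (y : Site) = level (x : Site) := ⟨x, rfl⟩
  rw [planeOcc, dif_pos h]
  refine occ_congr (weight_pos hq) ?_ j
  rw [weight, weight, h.choose_spec]

lemma weight_eq_of_level {q : ℝ} (hq : 0 < q) {x y : Λ} (h : level (x : Site) ≤ level (y : Site)) :
    weight q y = q ^ (2 * (level (y : Site) - level (x : Site)).toNat) * weight q x := by
  rw [weight, weight, mul_comm 2, pow_mul, ← mul_pow]
  congr 1
  rw [← zpow_natCast, Int.toNat_of_nonneg (by omega), ← zpow_add₀ hq.ne']
  congr 1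
  ring

/-- The exchange relation between sites in different planes. -/
lemma hole_particle_eq {q : ℝ} (hq : 0 < q) {j : ℕ} {x y : Λ}
    (h : level (x : Site) < level (y : Site)) :
    occ (weight q) (j + 2) y - occ₂ (weight q) (j + 2) x y =
      q ^ (2 * (level (y : Site) - level (x : Site)).toNat) *
        (occ (weight q) (j + 2) x - occ₂ (weight q) (j + 2) x y) := by
  have hxy : x ≠ y := by rintro rfl; exact lt_irrefl _ h
  have h1 := occ_exchange (w := weight q) hxy j
  rw [weight_eq_of_level hq h.le] at h1
  have h2 := (weight_pos hq x).ne'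
  refine mul_left_cancel₀ h2 ?_
  linarith

lemma occ_anti {q : ℝ} (hq : q ∈ Set.Ioo (0 : ℝ) 1) {j : ℕ} {x y : Λ}
    (h : level (x : Site) < level (y : Site)) :
    occ (weight q) (j + 2) y ≤ occ (weight q) (j + 2) x := by
  have hxy : x ≠ y := by rintro rfl; exact lt_irrefl _ h
  have h1 := hole_particle_eq (j := j) hq.1 h
  have h2 := occ₂_le_occ hxy j (weight_pos hq.1)
  have h3 : q ^ (2 * (level (y : Site) - level (x : Site)).toNat) ≤ 1 :=
    pow_le_one₀ hq.1.le hq.2.le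
  nlinarith

/-- Negative correlation and the exchange relation give exponential tails of the interface. -/
lemma occ_mul_hole_le {q : ℝ} (hq : 0 < q) {j : ℕ} (hn : j + 2 ≤ Fintype.card Λ) {x y : Λ}
    (h : level (x : Site) < level (y : Site)) :
    occ (weight q) (j + 2) y * (1 - occ (weight q) (j + 2) x) ≤
      q ^ (2 * (level (y : Site) - level (x : Site)).toNat) := by
  have hxy : x ≠ y := by rintro rfl; exact lt_irrefl _ h
  have h1 := hole_particle_eq (j := j) hq h
  have h2 := occ₂_le_mul hxy j (weight_pos hq) hn
  have h3 := occ_le_one (weight_pos hq) (j + 2) x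
  have h4 : 0 ≤ occ₂ (weight q) (j + 2) x y := by
    rw [occ₂_eq hxy]
    exact div_nonneg (mul_nonneg (mul_pos (weight_pos hq _) (weight_pos hq _)).le
      (esym_nonneg (weight_pos hq) _ _)) (esym_nonneg (weight_pos hq) _ _)
  have h5 : 0 ≤ q ^ (2 * (level (y : Site) - level (x : Site)).toNat) := by positivity
  nlinarith

end Planes

/-! ### Volumes composed of equal 111 planes -/

section Volume

variable {Λ : Finset Site} {a b : ℤ} {A : ℕ}

lemma IsLayeredVolume.card_eq (hΛ : IsLayeredVolume Λ a b A) :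
    Fintype.card Λ = (b - a).toNat * A := by
  rw [Fintype.card_coe, Finset.card_eq_sum_card_fiberwise (f := level) (t := Finset.Ioc a b)
    (fun x hx => Finset.mem_coe.2 (Finset.mem_Ioc.2 (hΛ.level_mem x hx))),
    Finset.sum_congr rfl fun l hl => hΛ.card_level l (Finset.mem_Ioc.1 hl), Finset.sum_const,
    Int.card_Ioc, smul_eq_mul]

lemma IsLayeredVolume.exists_level (hΛ : IsLayeredVolume Λ a b A) (hA : 0 < A) {l : ℤ}
    (hl : l ∈ Set.Ioc a b) : ∃ x : Λ, level (x : Site) = l := by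
  rw [← hΛ.card_level l hl] at hA
  obtain ⟨x, hx⟩ := Finset.card_pos.1 hA
  exact ⟨⟨x, (Finset.mem_filter.1 hx).1⟩, (Finset.mem_filter.1 hx).2⟩

/-- The occupations of the planes add up to the number of particles per site of a plane. -/
lemma IsLayeredVolume.sum_planeOcc (hΛ : IsLayeredVolume Λ a b A) {q : ℝ} (hq : 0 < q) (hA : 0 < A)
    {j : ℕ} (hn : j + 2 ≤ Fintype.card Λ) :
    ∑ l ∈ Finset.Ioc a b, planeOcc q Λ (j + 2) l = ((j + 2 : ℕ) : ℝ) / A := by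
  rw [eq_div_iff (by exact_mod_cast hA.ne'), ← sum_occ (weight_pos hq) hn,
    Finset.sum_congr rfl fun x _ => (planeOcc_level hq j x).symm,
    Finset.sum_coe_sort Λ (fun x => planeOcc q Λ (j + 2) (level x)),
    ← Finset.sum_fiberwise_of_maps_to (g := level) (t := Finset.Ioc a b)
      (fun x hx => Finset.mem_Ioc.2 (hΛ.level_mem x hx)), Finset.sum_mul]
  refine Finset.sum_congr rfl fun l hl => ?_
  rw [Finset.sum_congr rfl (g := fun _ => planeOcc q Λ (j + 2) l)
    fun x hx => by rw [(Finset.mem_filter.1 hx).2], Finset.sum_const,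
    hΛ.card_level l (Finset.mem_Ioc.1 hl), nsmul_eq_mul, mul_comm]

lemma IsLayeredVolume.covariance_le (hΛ : IsLayeredVolume Λ a b A) {q : ℝ} (hq : 0 < q) (hA : 1 < A)
    {j : ℕ} (hn : j + 2 ≤ Fintype.card Λ) {x y : Λ} (hxy : x ≠ y) :
    occ (weight q) (j + 2) x * occ (weight q) (j + 2) y - occ₂ (weight q) (j + 2) x y ≤
      1 / (A - 1) := by
  refine occ_mul_sub_occ₂_le (weight_pos hq) hn hA hxy ?_
  rw [← hΛ.card_level (level (y : Site)) (hΛ.level_mem y y.2)]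
  refine Finset.card_le_card_of_surjOn (fun z => (z : Site)) fun z hz => ?_
  have hz' := Finset.mem_filter.1 (Finset.mem_coe.1 hz)
  refine ⟨⟨z, hz'.1⟩, ?_, rfl⟩
  simp only [Finset.coe_filter, Finset.mem_univ, true_and, Set.mem_ofPred_eq]
  rw [weight, weight, hz'.2]

lemma hole_particle_le (hΛ : IsLayeredVolume Λ a b A) {q : ℝ} (hq : 0 < q) (hA : 1 < A)
    {j : ℕ} (hn : j + 2 ≤ Fintype.card Λ) {x y : Λ} (hxy : x ≠ y) :
    occ (weight q) (j + 2) y - occ₂ (weight q) (j + 2) x y ≤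
      (1 - occ (weight q) (j + 2) x) * occ (weight q) (j + 2) y + 1 / (A - 1) := by
  linarith [hΛ.covariance_le hq hA hn hxy]

/-- The probability of a hole just below a particle. By the exchange relation it is `q` times the
geometric mean of its value and of the probability of the opposite arrangement; for independent
occupation numbers this is `q` times the geometric mean of the variances. -/
lemma hole_particle_le_variance (hΛ : IsLayeredVolume Λ a b A) {q : ℝ} (hq : q ∈ Set.Ioo (0 : ℝ) 1)
    (hA : 1 < A) {j : ℕ} (hn : j + 2 ≤ Fintype.card Λ) {x y : Λ} (h : IsAbove (x : Site) y) :
    occ (weight q) (j + 2) y - occ₂ (weight q) (j + 2) x y ≤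
      1 / (A - 1) +
        q * ((planeVar q Λ (j + 2) (level x) + planeVar q Λ (j + 2) (level x + 1)) / 2) := by
  have hlt : level (x : Site) < level (y : Site) := by rw [h.2]; omega
  have h1 := hole_particle_eq (j := j) hq.1 hlt
  rw [h.2, add_sub_cancel_left, show 2 * (1 : ℤ).toNat = 2 from rfl] at h1
  have h2 := hΛ.covariance_le hq.1 hA hn h.ne
  have h3 := occ₂_le_mul h.ne j (weight_pos hq.1) hn
  rw [planeVar, planeVar, ← h.2, planeOcc_level hq.1, planeOcc_level hq.1]
  have p1 := occ_nonneg (weight_pos hq.1) (j + 2) x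
  have p2 := occ_le_one (weight_pos hq.1) (j + 2) x
  have p3 := occ_nonneg (weight_pos hq.1) (j + 2) y
  have p4 := occ_le_one (weight_pos hq.1) (j + 2) y
  generalize occ (weight q) (j + 2) x = p at *
  generalize occ (weight q) (j + 2) y = p' at *
  generalize occ₂ (weight q) (j + 2) x y = r at *
  -- With `c = -cov`, both `(p' - r) - c` and `(p - r) - c` are products of marginals.
  obtain ⟨c, hc⟩ : ∃ c, c = p * p' - r := ⟨_, rfl⟩
  have hq0 := hq.1
  have hq1 := hq.2
  have hc0 : 0 ≤ c := by linarith
  have hX : p' - r - c = (1 - p) * p' := by rw [hc]; ring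
  have hY : p' - r - c ≤ q ^ 2 * (p * (1 - p')) := by
    have : p * (1 - p') = p - r - c := by rw [hc]; ring
    have hqc : q ^ 2 * c ≤ c := mul_le_of_le_one_left hc0 (pow_le_one₀ hq0.le hq1.le)
    rw [this, h1]
    linarith
  have hX0 : 0 ≤ p' - r - c := by rw [hX]; exact mul_nonneg (by linarith) p3
  have hsq : (p' - r - c) ^ 2 ≤ (q * ((p * (1 - p) + p' * (1 - p')) / 2)) ^ 2 := by
    have e1 : (p' - r - c) ^ 2 ≤ (q ^ 2 * (p * (1 - p'))) * ((1 - p) * p') := by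
      rw [sq, ← hX]
      exact mul_le_mul_of_nonneg_right hY hX0
    have e2 : (p * (1 - p)) * (p' * (1 - p')) ≤ ((p * (1 - p) + p' * (1 - p')) / 2) ^ 2 := by
      nlinarith [sq_nonneg (p * (1 - p) - p' * (1 - p'))]
    nlinarith [mul_le_mul_of_nonneg_left e2 (sq_nonneg q)]
  have e3 : 0 ≤ q * ((p * (1 - p) + p' * (1 - p')) / 2) :=
    mul_nonneg hq0.le (by nlinarith [mul_nonneg p1 (sub_nonneg.2 p2), mul_nonneg p3 (sub_nonneg.2 p4)])
  have e4 := abs_le_of_sq_le_sq' hsq e3 |>.2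
  linarith

/-- The plane `m` or the plane `m + 1` has a variance bounded from below. -/
lemma IsLayeredVolume.le_planeVar (hΛ : IsLayeredVolume Λ a b A) {q ν η : ℝ}
    (hq : q ∈ Set.Ioo (0 : ℝ) 1) (hν : ν ∈ Set.Ico (0 : ℝ) 1) (hη : 0 < η) (hηq : η ≤ q)
    (hην : η * (1 - q)⁻¹ + η ≤ (1 - ν) / 4) (hA : 1 < A) (hAq : 1 / ((A : ℝ) - 1) ≤ q ^ 2 / 16)
    {j : ℕ} (hn : j + 2 ≤ Fintype.card Λ) {m : ℤ} (ham : a < m) (hmb : m + 1 ≤ b)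
    (hsum : ((j + 2 : ℕ) : ℝ) / A + a - m ∈ Set.Icc (-(1 / 2)) ((1 + ν) / 2)) :
    η ^ 2 / 8 ≤ planeVar q Λ (j + 2) m ∨ η ^ 2 / 8 ≤ planeVar q Λ (j + 2) (m + 1) := by
  have hlev : ∀ l l', a < l → l < l' → l' ≤ b → ∃ x y : Λ, level (x : Site) = l ∧
      level (y : Site) = l' ∧ planeOcc q Λ (j + 2) l = occ (weight q) (j + 2) x ∧
      planeOcc q Λ (j + 2) l' = occ (weight q) (j + 2) y := by
    intro l l' h1 h2 h3
    obtain ⟨x, hx⟩ := hΛ.exists_level (by omega) (l := l) ⟨h1, by omega⟩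
    obtain ⟨y, hy⟩ := hΛ.exists_level (by omega) (l := l') ⟨by omega, h3⟩
    exact ⟨x, y, hx, hy, by rw [← hx, planeOcc_level hq.1], by rw [← hy, planeOcc_level hq.1]⟩
  rw [← hΛ.sum_planeOcc hq.1 (by omega) hn] at hsum
  refine exists_partially_filled hq hν hη hηq hην (planeOcc_mem hq.1 _) ham hmb ?_ ?_ ?_ hsum
  · intro l l' h1 h2 h3
    obtain ⟨x, y, rfl, rfl, e1, e2⟩ := hlev l l' h1 h2 h3
    rw [e1, e2]
    exact occ_anti hq h2
  · intro l l' h1 h2 h3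
    obtain ⟨x, y, rfl, rfl, e1, e2⟩ := hlev l l' h1 h2 h3
    rw [e1, e2]
    exact occ_mul_hole_le hq.1 hn h2
  · obtain ⟨x, y, hx, hy, e1, e2⟩ := hlev m (m + 1) ham (by omega) hmb
    rw [e1, e2]
    have hlt : level (x : Site) < level (y : Site) := by omega
    have hxy : x ≠ y := by rintro rfl; exact lt_irrefl _ hlt
    have h1 := hole_particle_eq (j := j) hq.1 hlt
    rw [hx, hy, add_sub_cancel_left, show 2 * (1 : ℤ).toNat = 2 from rfl] at h1
    have h2 := hole_particle_le hΛ hq.1 hA hn hxy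
    have h3 := occ₂_le_mul hxy j (weight_pos hq.1) hn
    nlinarith [mul_le_mul_of_nonneg_left h3 (sq_nonneg q)]

/-- The total variance of one site from each of the planes of heights `-h, …, h`. -/
def totalVar (q : ℝ) (Λ : Finset Site) (n h : ℕ) : ℝ :=
  ∑ l ∈ Finset.Icc (-(h : ℤ)) h, planeVar q Λ n l

lemma sum_Ico_planeVar_le {q : ℝ} (hq : 0 < q) (n h : ℕ) :
    ∑ l ∈ Finset.Ico (-(h : ℤ)) h, (planeVar q Λ n l + planeVar q Λ n (l + 1)) / 2 ≤
      totalVar q Λ n h := by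
  have h1 : ∑ l ∈ Finset.Ico (-(h : ℤ)) h, planeVar q Λ n l ≤ totalVar q Λ n h :=
    Finset.sum_le_sum_of_subset_of_nonneg Finset.Ico_subset_Icc_self
      fun l _ _ => planeVar_nonneg hq n l
  have h2 : ∑ l ∈ Finset.Ico (-(h : ℤ)) h, planeVar q Λ n (l + 1) ≤ totalVar q Λ n h := by
    rw [← Finset.sum_image (f := planeVar q Λ n) (g := fun l => l + 1)
      (fun l _ l' _ hl => by simpa using hl)]
    refine Finset.sum_le_sum_of_subset_of_nonneg ?_ fun l _ _ => planeVar_nonneg hq n l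
    intro l hl
    obtain ⟨l', hl', rfl⟩ := Finset.mem_image.1 hl
    have := Finset.mem_Ico.1 hl'
    exact Finset.mem_Icc.2 ⟨by omega, by omega⟩
  rw [← Finset.sum_div, Finset.sum_add_distrib]
  linarith

/-- The Dirichlet form of the tent: inside, a bond of slope one in height costs `q` times the
variance of its planes; where the tent breaks off the configuration is almost frozen. -/
lemma dirichletForm_tent_le (hΛ : IsLayeredVolume Λ a b A) {q : ℝ} (hq : q ∈ Set.Ioo (0 : ℝ) 1)
    (hA : 1 < A) {j : ℕ} (hn : j + 2 ≤ Fintype.card Λ) (N h : ℕ) (K : Site) {l₀ : ℤ}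
    (hl₀ : l₀ ∈ Set.Ioc a b) (hh : -(h : ℤ) ≤ l₀ ∧ l₀ ≤ h) {ε θ : ℝ} (hε : 0 < ε)
    (hv : ε ≤ planeVar q Λ (j + 2) l₀) (hθ₁ : q ^ (2 * (h + 1 - l₀).toNat) ≤ ε * θ)
    (hθ₂ : q ^ (2 * (h + 1 + l₀).toNat) ≤ ε * θ) :
    dirichletForm q Λ (j + 2) (tent N h K) ≤ (2 * N + 1) ^ 2 *
      (2 * q * totalVar q Λ (j + 2) h + (4 * h + 6 * N ^ 2) * (1 / (A - 1)) + 6 * N ^ 2 * θ) := by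
  have hA' : (0 : ℝ) < 1 / (A - 1) := by
    have : (1 : ℝ) < A := by exact_mod_cast hA
    exact one_div_pos.2 (by linarith)
  set c : ℝ := 1 / (A - 1) with hc
  set v := planeVar q Λ (j + 2) with hvdef
  have hvnn : ∀ l, 0 ≤ v l := planeVar_nonneg hq.1 _
  have hθ : 0 < θ := pos_of_mul_pos_right ((pow_pos hq.1 _).trans_le hθ₁) hε.le
  obtain ⟨z, hz⟩ := hΛ.exists_level (by omega) hl₀
  have hv' : ε ≤ occ (weight q) (j + 2) z * (1 - occ (weight q) (j + 2) z) := by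
    rw [hvdef, planeVar, ← hz, planeOcc_level hq.1] at hv
    exact hv
  have z0 := occ_nonneg (weight_pos hq.1) (j + 2) z
  have z1 := occ_le_one (weight_pos hq.1) (j + 2) z
  have hz0 : ε ≤ occ (weight q) (j + 2) z := by nlinarith
  have hz1 : ε ≤ 1 - occ (weight q) (j + 2) z := by nlinarith
  set Q : ℤ → ℝ := fun l => c + if -(h : ℤ) ≤ l ∧ l < h then q * ((v l + v (l + 1)) / 2) else θ
    with hQ
  have hQnn : ∀ l, 0 ≤ Q l := by
    intro l
    simp only [hQ]
    split_ifs
    · have := mul_nonneg hq.1.le (add_nonneg (hvnn l) (hvnn (l + 1)))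
      linarith
    · linarith
  set g : ℤ → ℝ := fun l => Q l * slopeBound N h l with hg
  have hgnn : ∀ l, 0 ≤ g l := fun l => mul_nonneg (hQnn l) (slopeBound_nonneg N h l)
  have hgI : ∀ l ∉ Finset.Icc (-(h : ℤ) - 1) h, g l = 0 := by
    intro l hl
    rw [Finset.mem_Icc] at hl
    simp only [hg, slopeBound]
    rw [if_neg (by omega), if_neg (by omega), mul_zero]
  have hbond : ∀ x y : Λ, IsAbove (x : Site) y →
      (occ (weight q) (j + 2) y - occ₂ (weight q) (j + 2) x y) * (tent N h K x - tent N h K y) ^ 2 ≤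
        Q (level x) * (tent N h K x - tent N h K y) ^ 2 := by
    intro x y hxy
    have hlt : level (x : Site) < level (y : Site) := by rw [hxy.2]; omega
    have hsq := sq_nonneg (tent N h K x - tent N h K y)
    by_cases h1 : -(h : ℤ) ≤ level (x : Site) ∧ level (x : Site) < h
    · refine mul_le_mul_of_nonneg_right ?_ hsq
      simp only [hQ]
      rw [if_pos h1]
      exact hole_particle_le_variance hΛ hq hA hn hxy
    have p0 := occ_nonneg (weight_pos hq.1) (j + 2) y
    have p1 := occ_le_one (weight_pos hq.1) (j + 2) y
    have p2 := occ_nonneg (weight_pos hq.1) (j + 2) x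
    have p3 := occ_le_one (weight_pos hq.1) (j + 2) x
    have hgen : (1 - occ (weight q) (j + 2) x) * occ (weight q) (j + 2) y ≤ θ →
        (occ (weight q) (j + 2) y - occ₂ (weight q) (j + 2) x y) *
          (tent N h K x - tent N h K y) ^ 2 ≤ Q (level x) * (tent N h K x - tent N h K y) ^ 2 := by
      intro h2
      refine mul_le_mul_of_nonneg_right ?_ hsq
      simp only [hQ]
      rw [if_neg h1]
      linarith [hole_particle_le hΛ hq.1 hA hn hxy.ne]
    by_cases h2 : level (x : Site) = h
    · refine hgen ?_
      have h3 := occ_mul_hole_le hq.1 hn (x := z) (y := y) (by rw [hz, hxy.2]; omega)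
      rw [hz, hxy.2, h2] at h3
      have h4 := mul_le_mul_of_nonneg_left hz1 p0
      have h5 : occ (weight q) (j + 2) y ≤ θ := le_of_mul_le_mul_left (by linarith) hε
      nlinarith
    by_cases h3 : level (x : Site) = -h - 1
    · refine hgen ?_
      have h3' := occ_mul_hole_le hq.1 hn (x := x) (y := z) (by rw [hz]; omega)
      rw [hz, h3, show l₀ - (-(h : ℤ) - 1) = h + 1 + l₀ by ring] at h3'
      have h4 := mul_le_mul_of_nonneg_right hz0 (sub_nonneg.2 p3)
      have h5 : 1 - occ (weight q) (j + 2) x ≤ θ := le_of_mul_le_mul_left (by linarith) hε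
      nlinarith
    · have t1 : tent N h K x = 0 := by
        rw [tent, if_neg]
        rw [abs_le]
        omega
      have t2 : tent N h K y = 0 := by
        rw [tent, if_neg]
        rw [abs_le, hxy.2]
        omega
      rw [t1, t2]
      simp
  have hgsum : ∑ l ∈ Finset.Icc (-(h : ℤ) - 1) h, g l ≤
      2 * q * totalVar q Λ (j + 2) h + (4 * h + 6 * N ^ 2) * c + 6 * N ^ 2 * θ := by
    have e1 : Finset.Icc (-(h : ℤ) - 1) h =
        insert (-(h : ℤ) - 1) (insert (h : ℤ) (Finset.Ico (-(h : ℤ)) h)) := by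
      ext l
      simp only [Finset.mem_Icc, Finset.mem_insert, Finset.mem_Ico]
      omega
    rw [e1, Finset.sum_insert (by simp only [Finset.mem_insert, Finset.mem_Ico]; omega),
      Finset.sum_insert (by simp)]
    have e2 : g (-(h : ℤ) - 1) = (c + θ) * (3 * N ^ 2) := by
      simp only [hg, hQ]
      rw [slopeBound, if_neg (by omega), if_neg (by omega), if_pos (by omega)]
    have e3 : g h = (c + θ) * (3 * N ^ 2) := by
      simp only [hg, hQ]
      rw [slopeBound, if_neg (by omega), if_neg (by omega), if_pos (by omega)]
    have e4 : ∑ l ∈ Finset.Ico (-(h : ℤ)) h, g l =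
        4 * h * c + 2 * q * ∑ l ∈ Finset.Ico (-(h : ℤ)) h, (v l + v (l + 1)) / 2 := by
      have : ∀ l ∈ Finset.Ico (-(h : ℤ)) h, g l = 2 * c + 2 * q * ((v l + v (l + 1)) / 2) := by
        intro l hl
        simp only [hg, hQ, slopeBound]
        rw [if_pos (Finset.mem_Ico.1 hl), if_pos (Finset.mem_Ico.1 hl)]
        ring
      rw [Finset.sum_congr rfl this, Finset.sum_add_distrib, Finset.sum_const, ← Finset.mul_sum,
        Int.card_Ico, nsmul_eq_mul, show ((h : ℤ) - -(h : ℤ)).toNat = 2 * h by omega]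
      push_cast
      ring
    rw [e2, e3, e4]
    have e5 := mul_le_mul_of_nonneg_left (sum_Ico_planeVar_le (Λ := Λ) hq.1 (j + 2) h) hq.1.le
    linarith
  calc dirichletForm q Λ (j + 2) (tent N h K)
      ≤ ∑ x : Λ, ∑ y : Λ, Q (level x) *
          (if IsAbove (x : Site) y then (tent N h K x - tent N h K y) ^ 2 else 0) := by
        refine Finset.sum_le_sum fun x _ => Finset.sum_le_sum fun y _ => ?_
        split_ifs with hxy
        · exact hbond x y hxy
        · simp
    _ ≤ ∑ x : Λ, if axisDist K x ≤ N then g (level x) else 0 := by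
        refine Finset.sum_le_sum fun x _ => ?_
        rw [← Finset.mul_sum]
        refine (mul_le_mul_of_nonneg_left (sum_isAbove_le N h K x) (hQnn _)).trans ?_
        split_ifs
        · exact le_rfl
        · simp
    _ ≤ (2 * N + 1) ^ 2 * ∑ l ∈ Finset.Icc (-(h : ℤ) - 1) h, g l := sum_level_le Λ N K hgnn hgI
    _ ≤ _ := mul_le_mul_of_nonneg_left hgsum (by positivity)

/-- The variance of the tent statistic: the occupation numbers are almost uncorrelated. -/
lemma le_variance_tent (hΛ : IsLayeredVolume Λ a b A) {q : ℝ} (hq : q ∈ Set.Ioo (0 : ℝ) 1)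
    (hA : 1 < A) {j : ℕ} (hn : j + 2 ≤ Fintype.card Λ) {N h : ℕ} {K : Site}
    (hsupp : ∀ x, tent N h K x ≠ 0 → x ∈ Λ) :
    (N : ℝ) ^ 4 / 2 * totalVar q Λ (j + 2) h -
        1 / (A - 1) * ((2 * N + 1) ^ 2 * ((2 * h + 1) * N)) ^ 2 ≤
      canonMean (weight q : Λ → ℝ) (j + 2) (fun T => (∑ x ∈ T, tent N h K x -
        ∑ x : Λ, tent N h K x * occ (weight q) (j + 2) x) ^ 2) := by
  have hA' : (0 : ℝ) ≤ 1 / (A - 1) := by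
    have : (1 : ℝ) < A := by exact_mod_cast hA
    exact (one_div_pos.2 (by linarith)).le
  have h1 := le_canonMean_variance (weight_pos hq.1) hn (f := fun x : Λ => tent N h K x)
    (fun x => tent_nonneg N h K x) hA' (fun x y hxy _ _ => hΛ.covariance_le hq.1 hA hn hxy)
  have h2 := le_sum_tent_sq_mul hsupp (planeVar_nonneg (Λ := Λ) hq.1 (j + 2))
  have h3 : ∑ x : Λ, tent N h K x ≤ (2 * N + 1) ^ 2 * ((2 * h + 1) * N) := by
    have e1 := sum_level_le Λ N K (g := fun l => if |l| ≤ h then (N : ℝ) else 0)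
      (I := Finset.Icc (-(h : ℤ)) h) (fun l => by positivity)
      (fun l hl => if_neg fun h => hl (Finset.mem_Icc.2 (abs_le.1 h)))
    have e2 : ∑ l ∈ Finset.Icc (-(h : ℤ)) h, (if |l| ≤ h then (N : ℝ) else 0) = (2 * h + 1) * N := by
      rw [Finset.sum_congr rfl fun l hl => if_pos (abs_le.2 (Finset.mem_Icc.1 hl)),
        Finset.sum_const, Int.card_Icc, nsmul_eq_mul,
        show ((h : ℤ) + 1 - -(h : ℤ)).toNat = 2 * h + 1 by omega]
      push_cast
      ring
    rw [e2] at e1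
    refine le_trans (Finset.sum_le_sum fun x _ => ?_) e1
    by_cases hx : tent N h K x = 0
    · rw [hx]
      positivity
    · obtain ⟨e3, e4⟩ := tent_ne_zero hx
      rw [if_pos e4.le, if_pos e3]
      exact tent_le N h K x
  have h4 : (∑ x : Λ, tent N h K x) ^ 2 ≤ ((2 * N + 1) ^ 2 * ((2 * h + 1) * N) : ℝ) ^ 2 :=
    pow_le_pow_left₀ (Finset.sum_nonneg fun (x : Λ) _ => tent_nonneg N h K x) h3 2
  have h5 := mul_le_mul_of_nonneg_left h4 hA'
  have h6 : ∑ x : Λ, tent N h K x ^ 2 * planeVar q Λ (j + 2) (level x) = ∑ x : Λ,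
      tent N h K x ^ 2 * (occ (weight q) (j + 2) x * (1 - occ (weight q) (j + 2) x)) :=
    Finset.sum_congr rfl fun x _ => by rw [planeVar, planeOcc_level hq.1]
  rw [h6] at h2
  rw [totalVar]
  linarith

end Volume

/-! ### The excitation energy of a tent -/

section Gap

/-- In a large volume the tent statistic has an excitation energy of at most `t`, if `t` exceeds
by a margin the ratio of the slopes and the squares of the tent in a plane. The margin absorbs the
correlations, of order `1 / A`, and the contributions of the planes where the tent breaks off. -/
lemma exists_mem_excitationEnergies_le {Λ : Finset Site} {a b : ℤ} {A : ℕ}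
    (hΛ : IsLayeredVolume Λ a b A) {q : ℝ} (hq : q ∈ Set.Ioo (0 : ℝ) 1) (hA : 1 < A) {j : ℕ}
    (hn : j + 2 ≤ Fintype.card Λ) {N h : ℕ} (hN : 0 < N) {K : Site}
    (hsupp : ∀ x, tent N h K x ≠ 0 → x ∈ Λ) {S : Set Site} (hS : ∀ x, tent N h K x ≠ 0 → x ∈ S)
    {l₀ : ℤ} (hl₀ : l₀ ∈ Set.Ioc a b) (hh : -(h : ℤ) ≤ l₀ ∧ l₀ ≤ h) {ε θ t : ℝ} (hε : 0 < ε)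
    (ht : 0 < t) (hv : ε ≤ planeVar q Λ (j + 2) l₀)
    (hθ₁ : q ^ (2 * (h + 1 - l₀).toNat) ≤ ε * θ) (hθ₂ : q ^ (2 * (h + 1 + l₀).toNat) ≤ ε * θ)
    (hslope : 4 * q * (2 * N + 1) ^ 2 ≤ 2 / 5 * (t * N ^ 4))
    (hθt : (2 * N + 1) ^ 2 * (12 * N ^ 2 * θ) ≤ 1 / 20 * (t * N ^ 4 * ε))
    (hAt : 1 / ((A : ℝ) - 1) * ((2 * N + 1) ^ 2 * (2 * (4 * h + 6 * N ^ 2)) +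
      t * ((2 * N + 1) ^ 2 * ((2 * h + 1) * N)) ^ 2) ≤ 1 / 20 * (t * N ^ 4 * ε))
    {c : ℂ} (hc : c ≠ 0) :
    ∃ e ∈ excitationEnergies ((q + q⁻¹) / 2) (c • groundVector q (j + 2) : State Λ) S, e ≤ t := by
  have hD := dirichletForm_tent_le hΛ hq hA hn N h K hl₀ hh hε hv hθ₁ hθ₂
  have hV := le_variance_tent hΛ hq hA hn hsupp
  have hmem := fun hvar => mem_excitationEnergies hq hn hc (f := tent N h K) (S := S)
    (fun x hx => by by_contra h0; exact hx (hS x h0)) hvar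
  have hW : ε ≤ totalVar q Λ (j + 2) h :=
    hv.trans (Finset.single_le_sum (f := planeVar q Λ (j + 2))
      (fun l _ => planeVar_nonneg hq.1 _ l) (Finset.mem_Icc.2 hh))
  have hc0 : (0 : ℝ) < 1 / (A - 1) := by
    have : (1 : ℝ) < A := by exact_mod_cast hA
    exact one_div_pos.2 (by linarith)
  have hN4 : (0 : ℝ) < N ^ 4 := by positivity
  generalize canonMean (weight q : Λ → ℝ) (j + 2) (fun T => (∑ x ∈ T, tent N h K x -
    ∑ x : Λ, tent N h K x * occ (weight q) (j + 2) x) ^ 2) = V at *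
  generalize dirichletForm q Λ (j + 2) (tent N h K) = D at *
  generalize totalVar q Λ (j + 2) h = W at *
  generalize (1 : ℝ) / (A - 1) = κ at *
  have hW1 : t * N ^ 4 * ε ≤ t * N ^ 4 * W := mul_le_mul_of_nonneg_left hW (by positivity)
  have hW2 := mul_le_mul_of_nonneg_right hslope (hε.le.trans hW)
  have hE : (0 : ℝ) ≤ κ * ((2 * N + 1) ^ 2 * (2 * (4 * h + 6 * N ^ 2))) := by positivity
  have hV1 := mul_le_mul_of_nonneg_left hV ht.le
  have hDV : 2 * D ≤ t * V := by nlinarith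
  have hVpos : 0 < V := by
    have h1 : 0 < t * N ^ 4 * ε := by positivity
    have h2 : 0 < t * V := by nlinarith
    exact pos_of_mul_pos_right h2 ht.le
  refine ⟨_, hmem hVpos, ?_⟩
  have h1 : D / V ≤ t / 2 := by
    rw [div_le_iff₀ hVpos]
    linarith
  have h2 : 2 / (1 + q ^ 2) ≤ 2 := div_le_self zero_le_two (by nlinarith [sq_nonneg q])
  calc _ ≤ 2 / (1 + q ^ 2) * (t / 2) := mul_le_mul_of_nonneg_left h1 (by positivity)
    _ ≤ 2 * (t / 2) := mul_le_mul_of_nonneg_right h2 (by positivity)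
    _ = t := by ring

section Limit

variable {Λ : ℕ → Finset Site} {a b : ℕ → ℤ} {A : ℕ → ℕ}

lemma eventually_level_mem (hΛ : ∀ k, IsLayeredVolume (Λ k) (a k) (b k) (A k))
    (hcover : ∀ x : Site, ∀ᶠ k in atTop, x ∈ Λ k) (l : ℤ) :
    ∀ᶠ k in atTop, l ∈ Set.Ioc (a k) (b k) := by
  filter_upwards [hcover ![l, 0, 0]] with k hk
  have := (hΛ k).level_mem _ hk
  simpa [level, Fin.sum_univ_three] using this

/-- The planes become arbitrarily large, since they contain the sites `(i, -i, 0)`. -/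
lemma eventually_le_card_level (hΛ : ∀ k, IsLayeredVolume (Λ k) (a k) (b k) (A k))
    (hcover : ∀ x : Site, ∀ᶠ k in atTop, x ∈ Λ k) (M : ℕ) : ∀ᶠ k in atTop, M ≤ A k := by
  set g : ℕ → Site := fun i => ![(i : ℤ), -i, 0] with hg
  have hinj : Function.Injective g := fun i i' h => by
    have := congrFun h 0
    simpa [hg] using this
  have h1 : ∀ᶠ k in atTop, ∀ i ∈ Finset.range M, g i ∈ Λ k :=
    (Filter.eventually_all_finset _).2 fun i _ => hcover (g i)
  filter_upwards [h1, eventually_level_mem hΛ hcover 0] with k hk h0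
  rw [← (hΛ k).card_level 0 h0]
  calc M = ((Finset.range M).image g).card := by
        rw [Finset.card_image_of_injective _ hinj, Finset.card_range]
    _ ≤ _ := by
        refine Finset.card_le_card fun x hx => ?_
        obtain ⟨i, hi, rfl⟩ := Finset.mem_image.1 hx
        refine Finset.mem_filter.2 ⟨hk i hi, ?_⟩
        simp [hg, level, Fin.sum_univ_three]

lemma eventually_one_div_card_le (hΛ : ∀ k, IsLayeredVolume (Λ k) (a k) (b k) (A k))
    (hcover : ∀ x : Site, ∀ᶠ k in atTop, x ∈ Λ k) {κ : ℝ} (hκ : 0 < κ) :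
    ∀ᶠ k in atTop, 1 / ((A k : ℝ) - 1) ≤ κ := by
  obtain ⟨M, hM⟩ := exists_nat_gt (1 / κ + 1)
  filter_upwards [eventually_le_card_level hΛ hcover M] with k hk
  have h1 : (M : ℝ) ≤ A k := by exact_mod_cast hk
  have h2 : 0 < 1 / κ := one_div_pos.2 hκ
  rw [div_le_iff₀ (by linarith)]
  have h3 : κ * (1 / κ) = 1 := mul_one_div_cancel hκ.ne'
  nlinarith

end Limit

/-- An admissible exponent `δ`, uniform in the filling factor. It is so close to `1 / 2` that
`q ^ (2 * (1 - δ))` is at least `9 / 10` of its value `q` at `δ = 1 / 2`. -/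
def gapExponent (q : ℝ) : ℝ := (1 - min 1 (Real.log (9 / 10) / Real.log q)) / 2

lemma gapExponent_mem {q : ℝ} (hq : q ∈ Set.Ioo (0 : ℝ) 1) :
    gapExponent q ∈ Set.Ico (0 : ℝ) (1 / 2) := by
  have h1 : 0 < Real.log (9 / 10) / Real.log q :=
    div_pos_of_neg_of_neg (Real.log_neg (by norm_num) (by norm_num)) (Real.log_neg hq.1 hq.2)
  have h2 : min 1 (Real.log (9 / 10) / Real.log q) ≤ 1 := min_le_left _ _
  have h3 : 0 < min 1 (Real.log (9 / 10) / Real.log q) := lt_min one_pos h1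
  unfold gapExponent
  constructor <;> linarith

lemma le_rpow_gapExponent {q : ℝ} (hq : q ∈ Set.Ioo (0 : ℝ) 1) :
    9 / 10 * q ≤ q ^ (2 * (1 - gapExponent q)) := by
  have hlog : Real.log q < 0 := Real.log_neg hq.1 hq.2
  set s := min 1 (Real.log (9 / 10) / Real.log q) with hs
  have h1 : 2 * (1 - gapExponent q) = s + 1 := by
    rw [gapExponent, ← hs]
    ring
  have h2 : Real.log (9 / 10) ≤ Real.log q * s := by
    have : s ≤ Real.log (9 / 10) / Real.log q := min_le_right _ _
    rw [le_div_iff_of_neg hlog] at this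
    linarith
  rw [h1, Real.rpow_add_one hq.1.ne', Real.rpow_def_of_pos hq.1]
  refine mul_le_mul_of_nonneg_right ?_ hq.1.le
  rw [← Real.exp_log (show (0 : ℝ) < 9 / 10 by norm_num)]
  exact Real.exp_le_exp.2 h2

end Gap

end XXZ

end

theorem mainTheorem3 :
    ∃ δ : ℝ → ℝ → ℝ,
      (∀ q ∈ Set.Ioo (0 : ℝ) 1, ∀ ν ∈ Set.Ico (0 : ℝ) 1, δ q ν ∈ Set.Ico (0 : ℝ) (1 / 2)) ∧
      ∀ q ∈ Set.Ioo (0 : ℝ) 1, ∀ Δ : ℝ, Δ = (q + q⁻¹) / 2 →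
      ∀ ν ∈ Set.Ico (0 : ℝ) 1, ∀ m : ℤ,
      ∀ (Λ : ℕ → Finset XXZ.Site) (a b : ℕ → ℤ) (A n : ℕ → ℕ),
        (∀ k, XXZ.IsLayeredVolume (Λ k) (a k) (b k) (A k)) →
        (∀ x : XXZ.Site, ∀ᶠ k in atTop, x ∈ Λ k) →
        Tendsto (fun k => (n k : ℝ) / (A k : ℝ) + (a k : ℝ)) atTop (𝓝 ((m : ℝ) + ν)) →
      ∀ (c : EuclideanSpace ℝ (Fin 3)) (R : ℝ), 70 < R →
        ∃ h : ℕ, ∀ᶠ k in atTop,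
          (∃ ψ : XXZ.State (Λ k), XXZ.IsGroundState Δ (n k) ψ) ∧
          ∀ ψ : XXZ.State (Λ k), XXZ.IsGroundState Δ (n k) ψ →
            (XXZ.excitationEnergies Δ ψ (XXZ.cylinder c R h)).Nonempty ∧
            BddBelow (XXZ.excitationEnergies Δ ψ (XXZ.cylinder c R h)) ∧
            XXZ.gap Δ ψ (XXZ.cylinder c R h) ≤
              100 * (q ^ (2 * (1 - δ q ν)) / (1 - q ^ 2)) * (1 / R ^ 2) := by
  refine ⟨fun q _ => XXZ.gapExponent q, fun q hq ν _ => XXZ.gapExponent_mem hq, ?_⟩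
  rintro q hq Δ rfl ν hν m Λ a b A n hΛ hcover hlim c R hR
  obtain ⟨hq0, hq1⟩ := hq
  have hR0 : 0 < R := by linarith
  -- A radius slightly below `R / √2`, for which the hexagons fit into the cylinder.
  set N : ℕ := ⌈0.68 * R⌉₊ with hNdef
  have hN1 : 0.68 * R ≤ N := Nat.le_ceil _
  have hN2 : (N : ℝ) ≤ 0.68 * R + 1 := (Nat.ceil_lt_add_one (by positivity)).le
  have hN47 : (47 : ℝ) < N := by linarith
  have hN : 0 < N := by
    have : (0 : ℝ) < N := by linarith
    exact_mod_cast this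
  set K : XXZ.Site := fun i => round (c i)
  have hinv : 0 < (1 - q)⁻¹ := inv_pos.2 (by linarith)
  set η : ℝ := min q ((1 - ν) / 4 / ((1 - q)⁻¹ + 1)) with hηdef
  have hη : 0 < η := lt_min hq0 (div_pos (by linarith [hν.2]) (by linarith))
  have hηq : η ≤ q := min_le_left _ _
  have hην : η * (1 - q)⁻¹ + η ≤ (1 - ν) / 4 := by
    have h1 : η ≤ (1 - ν) / 4 / ((1 - q)⁻¹ + 1) := min_le_right _ _
    rw [le_div_iff₀ (by linarith)] at h1
    linarith
  set ε : ℝ := η ^ 2 / 8 with hεdef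
  have hε : 0 < ε := by positivity
  -- The bound to be reached; `δ` was chosen such that it implies the claim.
  set t : ℝ := 90 * q / R ^ 2 with htdef
  have ht : 0 < t := by positivity
  have hbound : t ≤ 100 * (q ^ (2 * (1 - XXZ.gapExponent q)) / (1 - q ^ 2)) * (1 / R ^ 2) := by
    have h1 := XXZ.le_rpow_gapExponent ⟨hq0, hq1⟩
    have h2 : 9 / 10 * q ≤ q ^ (2 * (1 - XXZ.gapExponent q)) / (1 - q ^ 2) := by
      rw [le_div_iff₀ (by nlinarith)]
      nlinarith [mul_pos hq0 (mul_pos hq0 hq0)]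
    have h3 : t = 100 * (9 / 10 * q) * (1 / R ^ 2) := by
      rw [htdef]
      ring
    rw [h3]
    exact mul_le_mul_of_nonneg_right (mul_le_mul_of_nonneg_left h2 (by norm_num)) (by positivity)
  have hslope : 4 * q * (2 * N + 1) ^ 2 ≤ 2 / 5 * (t * N ^ 4) := by
    have h1 : R ^ 2 * (2 * N + 1) ^ 2 ≤ 9 * (N : ℝ) ^ 4 := by
      have h2 : R * (2 * N + 1) ≤ 3 * (N : ℝ) ^ 2 := by nlinarith
      have h3 := pow_le_pow_left₀ (by positivity) h2 2
      nlinarith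
    have h2 : 2 / 5 * (t * N ^ 4) = 4 * q * (9 * (N : ℝ) ^ 4 / R ^ 2) := by
      rw [htdef]
      ring
    rw [h2]
    refine mul_le_mul_of_nonneg_left ?_ (by positivity)
    rw [le_div_iff₀ (by positivity)]
    linarith
  -- The error allowed for the planes where the tent breaks off; it determines `h`.
  set θ : ℝ := 1 / 20 * (t * N ^ 4 * ε) / ((2 * N + 1) ^ 2 * (12 * N ^ 2)) with hθdef
  have hθ : 0 < θ := by positivity
  have hθt : (2 * N + 1) ^ 2 * (12 * N ^ 2 * θ) ≤ 1 / 20 * (t * N ^ 4 * ε) := by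
    rw [← mul_assoc, hθdef, mul_div_cancel₀ _ (by positivity)]
  obtain ⟨p, hp⟩ := exists_pow_lt_of_lt_one (mul_pos hε hθ) hq1
  set h : ℕ := m.natAbs + 2 + p with hhdef
  have hpow : ∀ d : ℕ, p ≤ d → q ^ d ≤ ε * θ := fun d hd =>
    (pow_le_pow_of_le_one hq0.le hq1.le hd).trans hp.le
  -- The coefficient of the errors of order `1 / A`.
  set C : ℝ := (2 * N + 1) ^ 2 * (2 * (4 * h + 6 * N ^ 2)) +
    t * ((2 * N + 1) ^ 2 * ((2 * h + 1) * N)) ^ 2 with hC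
  have hC0 : 0 < C := by positivity
  clear_value C h θ t N
  refine ⟨h, ?_⟩
  have hsupp : ∀ᶠ k in atTop, ∀ x, XXZ.tent N h K x ≠ 0 → x ∈ Λ k :=
    (XXZ.finite_support_tent N h K).eventually_all.2 fun x _ => hcover x
  -- The excess over `m` full planes is eventually bounded away from `-1` and from `1`.
  have hden : ∀ᶠ k in atTop, (n k : ℝ) / A k + a k ∈
      Set.Ioo ((m : ℝ) + ν - 1 / 2) (m + ν + (1 - ν) / 2) :=
    hlim (Ioo_mem_nhds (by linarith) (by linarith [hν.2]))
  filter_upwards [hsupp, hden, XXZ.eventually_level_mem hΛ hcover (m - 4),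
    XXZ.eventually_level_mem hΛ hcover (m + 2), XXZ.eventually_le_card_level hΛ hcover 2,
    XXZ.eventually_one_div_card_le hΛ hcover (show 0 < q ^ 2 / 16 by positivity),
    XXZ.eventually_one_div_card_le hΛ hcover
      (show 0 < 1 / 20 * (t * N ^ 4 * ε) / C by positivity)] with k hsupp hden hlow hhigh hA hAq hAC
  have hA0 : (0 : ℝ) < A k := by
    have : 0 < A k := by omega
    exact_mod_cast this
  have hlow' : (a k : ℝ) + 1 ≤ m - 4 := by
    have : a k + 1 ≤ m - 4 := hlow.1
    exact_mod_cast this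
  have hhigh' : (m : ℝ) + 2 ≤ b k := by exact_mod_cast hhigh.2
  have hν0 := hν.1
  have hν1 := hν.2
  obtain ⟨j, hj⟩ : ∃ j, n k = j + 2 := by
    have h1 : (2 : ℝ) ≤ n k / A k := by linarith [hden.1]
    rw [le_div_iff₀ hA0] at h1
    have h2 : 2 * A k ≤ n k := by exact_mod_cast h1
    exact ⟨n k - 2, by omega⟩
  have hn : j + 2 ≤ Fintype.card (Λ k) := by
    rw [← hj, (hΛ k).card_eq]
    have h1 : (n k : ℝ) / A k ≤ b k - a k := by linarith [hden.2]
    rw [div_le_iff₀ hA0] at h1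
    have h2 : (((b k - a k).toNat : ℕ) : ℝ) = b k - a k := by
      have h3 : (((b k - a k).toNat : ℕ) : ℤ) = b k - a k :=
        Int.toNat_of_nonneg (by have := hlow.1; have := hhigh.2; omega)
      exact_mod_cast h3
    rw [← h2] at h1
    exact_mod_cast h1
  have ham : a k < m := by have := hlow.1; omega
  have hmb : m + 1 ≤ b k := by have := hhigh.2; omega
  have hvar : ∃ l₀ : ℤ, (l₀ = m ∨ l₀ = m + 1) ∧ ε ≤ XXZ.planeVar q (Λ k) (j + 2) l₀ := by
    have h1 := (hΛ k).le_planeVar ⟨hq0, hq1⟩ hν hη hηq hην (by omega) hAq hn ham hmb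
      (by rw [← hj]; constructor <;> linarith [hden.1, hden.2])
    rcases h1 with h1 | h1
    · exact ⟨m, Or.inl rfl, h1⟩
    · exact ⟨m + 1, Or.inr rfl, h1⟩
  obtain ⟨l₀, hl₀, hv⟩ := hvar
  have hAt : 1 / ((A k : ℝ) - 1) * C ≤ 1 / 20 * (t * N ^ 4 * ε) := by
    rwa [← le_div_iff₀ hC0]
  rw [hC] at hAt
  have hl₀' : l₀ ∈ Set.Ioc (a k) (b k) := ⟨by omega, by omega⟩
  have hl₀h : -(h : ℤ) ≤ l₀ ∧ l₀ ≤ h := ⟨by omega, by omega⟩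
  have hp₁ := hpow (2 * (h + 1 - l₀).toNat) (by omega)
  have hp₂ := hpow (2 * (h + 1 + l₀).toNat) (by omega)
  rw [hj]
  refine ⟨⟨_, XXZ.isGroundState_groundVector ⟨hq0, hq1⟩ hn⟩, fun ψ hψ => ?_⟩
  obtain ⟨z, hz, rfl⟩ := hψ.eq_smul ⟨hq0, hq1⟩ hn (hΛ k).connected
  obtain ⟨e, he, het⟩ := XXZ.exists_mem_excitationEnergies_le (hΛ k) ⟨hq0, hq1⟩ (by omega) hn hN
    hsupp (fun x hx => XXZ.tent_mem_cylinder hR hN2 hx) hl₀' hl₀h hε ht hv hp₁ hp₂ hslope hθt hAt hz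
  have hbdd := XXZ.bddBelow_excitationEnergies ⟨hq0, hq1⟩
    (z • XXZ.groundVector q (j + 2) : XXZ.State (Λ k)) (XXZ.cylinder c R h)
  exact ⟨⟨e, he⟩, hbdd, (csInf_le hbdd he).trans (het.trans hbound)⟩
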